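/- Work in $\mathbb R^3$ with coordinates $(x,y,z)$ and the contact form $\alpha=dz-y\,dx$. A link is a finite (possibly empty) disjoint union of smoothly embedded oriented closed curves in $\mathbb R^3$; a knot is a link with one component; a link is Legendrian if $\alpha$ vanishes on its tangent vectors. **Cobordisms.** A (smooth, oriented) cobordism from a link $K_0$ to a link $K_1$ is a properly embedded oriented smooth surface $W\subset\mathbb R\times\mathbb R^3$ for which there are $T_0<T_1$ such that $W\cap([T_0,T_1]\times\mathbb R^3)$ is compact, $W\cap((-\infty,T_0]\times\mathbb R^3)=(-\infty,T_0]\times K_0$ and $W\cap([T_1,\infty)\times\mathbb R^3)=[T_1,\infty)\times K_1$, the cylinders being oriented as products. Its Euler characteristic is that of its compact part $W\cap([T_0,T_1]\times\mathbb R^3)$. A Lagrangian cobordism between Legendrian links is a cobordism $L$ on which $d(e^t\alpha)$ vanishes and $e^t\alpha|_L$ has a primitive that is constant on each of the two cylindrical ends. **Genus.** The genus $g$ of a compact oriented surface with $c$ connected components, $b$ boundary circles and Euler characteristic $\chi$ is determined by $\chi=2c-2g-b$ (for a connected surface, $\chi=2-2g-b$; in general $g$ is the sum of the genera of the components). The genus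 of a cobordism is that of its compact part. For knots $K,K'$, the smooth cobordism genus $g_s(K,K')$ is the minimum genus of all cobordisms from $K$ to $K'$. **Quasi-cobordisms.** A Lagrangian quasi-cobordism between Legendrian links $\Lambda$ and $\Lambda'$ consists of Legendrian links $\Lambda=\Lambda_0,\Lambda_1,\dots,\Lambda_n=\Lambda'$ ($n\ge1$), nonempty Legendrian links $\Lambda_1^*,\dots,\Lambda_n^*$, and Lagrangian cobordisms $L_1^<,L_1^>,\dots,L_n^<,L_n^>$ such that, for each $i$, either $L_i^<$ goes from $\Lambda_{i-1}$ to $\Lambda_i^*$ and $L_i^>$ from $\Lambda_i$ to $\Lambda_i^*$ (an upper bound), or $L_i^<$ goes from $\Lambda_i^*$ to $\Lambda_{i-1}$ and $L_i^>$ from $\Lambda_i^*$ to $\Lambda_i$ (a lower bound). Its Euler characteristic is $\chi=\sum_i\bigl(\chi(L_i^<)+\chi(L_i^>)\bigr)$. Its composite surface is obtained by stacking the compact parts of $L_1^<,L_1^>,\dots,L_n^<,L_n^>$ in this order (with cylindrical collars), after reversing the $t$-direction of $L_i^>$ at an upper bound and of $L_i^<$ at a lower bound. Its genus $g$ is determined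 by $\chi=2c-2g-b$, where $c$ is the number of connected components of the composite surface and $b$ is the total number of components of $\Lambda$ and $\Lambda'$. The relative Lagrangian genus $g_L(\Lambda,\Lambda')$ is the minimum genus of all Lagrangian quasi-cobordisms between $\Lambda$ and $\Lambda'$ ($+\infty$ if there is none). **Statement.** For all Legendrian knots $\Lambda$ and $\Lambda'$, $$g_s(\Lambda,\Lambda')\le g_L(\Lambda,\Lambda').$$ The same inequality holds for the connected versions: if $g_s^{c}$ is the minimum genus over connected cobordisms only, and $g_L^{c}$ the minimum genus over those Lagrangian quasi-cobordisms whose composite surface is connected, then $g_s^{c}(\Lambda,\Lambda')\le g_L^{c}(\Lambda,\Lambda')$. -/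

import Mathlib

open scoped ContDiff

namespace LegCob

/-- The space `ℝ³` with coordinates `(x, y, z) = (p 0, p 1, p 2)`. -/
abbrev Space3 : Type := Fin 3 → ℝ

/-- The product `ℝ × ℝ³` with coordinates `(t, p)`. -/
abbrev Space4 : Type := ℝ × Space3

/-- The standard contact form `α = dz - y dx` on `ℝ³`. -/
noncomputable def contactForm (p : Space3) : Space3 →L[ℝ] ℝ :=
  ContinuousLinearMap.proj (R := ℝ) (φ := fun _ : Fin 3 => ℝ) 2
    - p 1 • ContinuousLinearMap.proj (R := ℝ) (φ := fun _ : Fin 3 => ℝ) 0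

/-- The one-form `e^t α` on `ℝ × ℝ³`. -/
noncomputable def liouvilleForm (q : Space4) : Space4 →L[ℝ] ℝ :=
  Real.exp q.1 • (contactForm q.2).comp (ContinuousLinearMap.snd ℝ ℝ Space3)

/-- The symplectic form `d(e^t α)` of the symplectization, written with the formula
`dλ_q(u, v) = (D_u λ)_q(v) - (D_v λ)_q(u)` for the exterior derivative of a one-form. -/
noncomputable def symplecticForm (q u v : Space4) : ℝ :=
  fderiv ℝ liouvilleForm q u v - fderiv ℝ liouvilleForm q v u

/-- An oriented smooth link in `ℝ³` (possibly empty): finitely many disjoint embedded closed curves,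
given by regular `1`-periodic parametrizations, which also carry the orientation. -/
structure OrientedLink where
  numComponents : ℕ
  curve : Fin numComponents → ℝ → Space3
  smooth : ∀ i, ContDiff ℝ ∞ (curve i)
  periodic : ∀ i, Function.Periodic (curve i) 1
  regular : ∀ i s, deriv (curve i) s ≠ 0
  injective : ∀ i j s t, curve i s = curve j t → i = j ∧ ∃ k : ℤ, s = t + k

namespace OrientedLink

/-- The underlying point set of a link. -/
def range (K : OrientedLink) : Set Space3 := ⋃ i, Set.range (K.curve i)

/-- A knot is a link with exactly one component. -/
def IsKnot (K : OrientedLink) : Prop := K.numComponents = 1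

/-- A link is Legendrian if it is everywhere tangent to the contact planes `ker α`. -/
def IsLegendrian (K : OrientedLink) : Prop :=
  ∀ i s, contactForm (K.curve i s) (deriv (K.curve i) s) = 0

end OrientedLink

/-- `S ⊆ ℝ × ℝ³` is a smooth embedded surface without boundary: around each of its points there is a
smooth chart of the ambient space that flattens `S` onto the plane of vanishing second component. -/
def IsSmoothSurface (S : Set Space4) : Prop :=
  ∀ p ∈ S, ∃ Φ : OpenPartialHomeomorph Space4 ((ℝ × ℝ) × (ℝ × ℝ)),
    p ∈ Φ.source ∧ ContDiffOn ℝ ∞ Φ Φ.source ∧ ContDiffOn ℝ ∞ Φ.symm Φ.target ∧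
      ∀ q ∈ Φ.source, q ∈ S ↔ (Φ q).2 = 0

/-- `Ω` orients the surface `S`: it is a continuous field of alternating bilinear forms along `S`
that restricts to an area form on each tangent plane. (The tangent plane of a smooth surface at `p`
is its tangent cone `tangentConeAt ℝ S p`.) A tangent basis `(u, v)` is positive if
`Ω p u v > 0`. -/
structure IsOrientationForm (S : Set Space4) (Ω : Space4 → Space4 →L[ℝ] Space4 →L[ℝ] ℝ) : Prop where
  continuousOn : ContinuousOn Ω S
  alternating : ∀ p ∈ S, ∀ u, Ω p u u = 0
  nonvanishing : ∀ p ∈ S, ∀ u ∈ tangentConeAt ℝ S p, ∀ v ∈ tangentConeAt ℝ S p,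
    LinearIndependent ℝ ![u, v] → Ω p u v ≠ 0

/-- A smooth oriented cobordism from `K₀` to `K₁`: a properly embedded oriented smooth surface in
`ℝ × ℝ³` that is compact over `[T₀, T₁]` and agrees, as an oriented surface, with the cylinders
`ℝ × K₀` for `t ≤ T₀` and `ℝ × K₁` for `t ≥ T₁`. Both cylinders carry the product orientation, so
that the oriented boundary of the compact part is `K₁ - K₀`. -/
structure Cobordism (K₀ K₁ : OrientedLink) where
  carrier : Set Space4
  T₀ : ℝ
  T₁ : ℝ
  T₀_lt_T₁ : T₀ < T₁
  isSmoothSurface : IsSmoothSurface carrier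
  isCompact : IsCompact (carrier ∩ {q | T₀ ≤ q.1 ∧ q.1 ≤ T₁})
  lower_end : carrier ∩ {q | q.1 ≤ T₀} = Set.Iic T₀ ×ˢ K₀.range
  upper_end : carrier ∩ {q | T₁ ≤ q.1} = Set.Ici T₁ ×ˢ K₁.range
  orientable : ∃ Ω, IsOrientationForm carrier Ω ∧
    (∀ t ≤ T₀, ∀ i s, 0 < Ω (t, K₀.curve i s) (1, 0) (0, deriv (K₀.curve i) s)) ∧
    (∀ t, T₁ ≤ t → ∀ i s, 0 < Ω (t, K₁.curve i s) (1, 0) (0, deriv (K₁.curve i) s))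

/-- An exact oriented Lagrangian cobordism from `Λ₀` to `Λ₁` in the symplectization
`(ℝ × ℝ³, d(e^t α))`: the ends are Legendrian, the symplectic form vanishes on tangent vectors, and
`e^t α` has a smooth primitive on the surface that is constant (not merely locally constant) on each
of the two cylindrical ends. (The surface is closed in `ℝ × ℝ³`, so smooth functions on it are
the restrictions of smooth functions on `ℝ × ℝ³`.) -/
structure LagrangianCobordism (Λ₀ Λ₁ : OrientedLink) extends Cobordism Λ₀ Λ₁ where
  legendrian_lower : Λ₀.IsLegendrian
  legendrian_upper : Λ₁.IsLegendrian
  isLagrangian : ∀ q ∈ carrier, ∀ u ∈ tangentConeAt ℝ carrier q, ∀ v ∈ tangentConeAt ℝ carrier q,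
    symplecticForm q u v = 0
  isExact : ∃ f : Space4 → ℝ, ContDiff ℝ ∞ f ∧
    (∀ q ∈ carrier, ∀ u ∈ tangentConeAt ℝ carrier q, fderiv ℝ f q u = liouvilleForm q u) ∧
    (∃ c, ∀ q ∈ carrier, q.1 ≤ T₀ → f q = c) ∧
    (∃ c, ∀ q ∈ carrier, T₁ ≤ q.1 → f q = c)

/-- The compact surface `A` with boundary `B` has Euler characteristic `χ`: for a finite cell
decomposition of `A` into cells of dimension at most two in which `B` is a union of vertices and
edges, the number of vertices minus the number of edges plus the number of faces is `χ`. -/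
def HasEulerCharacteristic (A B : Set Space4) (χ : ℤ) : Prop :=
  ∃ _ : Topology.CWComplex A,
    (∀ n, Finite (Topology.RelCWComplex.cell A n)) ∧
    (∀ n, 2 < n → IsEmpty (Topology.RelCWComplex.cell A n)) ∧
    (∃ (I₀ : Set (Topology.RelCWComplex.cell A 0)) (I₁ : Set (Topology.RelCWComplex.cell A 1)),
      B = (⋃ i ∈ I₀, Topology.RelCWComplex.openCell 0 i) ∪
        (⋃ i ∈ I₁, Topology.RelCWComplex.openCell 1 i)) ∧
    χ = (Nat.card (Topology.RelCWComplex.cell A 0) : ℤ)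
      - Nat.card (Topology.RelCWComplex.cell A 1) + Nat.card (Topology.RelCWComplex.cell A 2)

/-- The number of connected components of a set. -/
noncomputable def numConnectedComponents (A : Set Space4) : ℕ := Nat.card (ConnectedComponents A)

/-- The relation between the genus `g` and the Euler characteristic `χ` of a compact oriented surface
with `c` connected components and `b` boundary circles: `χ = 2c - 2g - b`. For a connected surface
this is the usual `χ = 2 - 2g - b`; in general `g` is the sum of the genera of the components. -/
def GenusRelation (c b : ℕ) (χ : ℤ) (g : ℕ) : Prop := χ = 2 * (c : ℤ) - 2 * (g : ℤ) - (b : ℤ)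

namespace Cobordism

variable {K₀ K₁ : OrientedLink}

/-- The part of a cobordism between its two cylindrical ends, a compact surface with boundary. -/
def compactPart (W : Cobordism K₀ K₁) : Set Space4 :=
  W.carrier ∩ {q | W.T₀ ≤ q.1 ∧ q.1 ≤ W.T₁}

/-- The boundary of the compact part. -/
def boundary (W : Cobordism K₀ K₁) : Set Space4 :=
  ({W.T₀} ×ˢ K₀.range) ∪ ({W.T₁} ×ˢ K₁.range)

/-- The Euler characteristic of a cobordism is that of its compact part. -/
def HasEulerChar (W : Cobordism K₀ K₁) (χ : ℤ) : Prop :=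
  HasEulerCharacteristic W.compactPart W.boundary χ

/-- The cobordism `W` has genus `g`. -/
def HasGenus (W : Cobordism K₀ K₁) (g : ℕ) : Prop :=
  ∃ χ : ℤ, W.HasEulerChar χ ∧
    GenusRelation (numConnectedComponents W.compactPart) (K₀.numComponents + K₁.numComponents) χ g

/-- The part of `W` over `[T₀ - 1, T₁ + 1]` (the compact part with a cylindrical collar at each
end), moved to the slab `[k, k + 1] × ℝ³` by an increasing affine change of `t`. -/
def stacked (W : Cobordism K₀ K₁) (k : ℕ) : Set Space4 :=
  {q | (k : ℝ) ≤ q.1 ∧ q.1 ≤ k + 1 ∧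
    (W.T₀ - 1 + (q.1 - k) * (W.T₁ - W.T₀ + 2), q.2) ∈ W.carrier}

/-- As `stacked`, with the direction of `t` reversed. -/
def stackedReversed (W : Cobordism K₀ K₁) (k : ℕ) : Set Space4 :=
  {q | (k : ℝ) ≤ q.1 ∧ q.1 ≤ k + 1 ∧
    (W.T₁ + 1 - (q.1 - k) * (W.T₁ - W.T₀ + 2), q.2) ∈ W.carrier}

end Cobordism

/-- The smooth cobordism genus: the minimal genus of all smooth oriented cobordisms
from `K` to `K'`. -/
noncomputable def smoothCobordismGenus (K K' : OrientedLink) : ℕ∞ :=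
  ⨅ (W : Cobordism K K') (g : ℕ) (_ : W.HasGenus g), (g : ℕ∞)

/-- The minimal genus of the connected smooth oriented cobordisms from `K` to `K'`. -/
noncomputable def connectedSmoothCobordismGenus (K K' : OrientedLink) : ℕ∞ :=
  ⨅ (W : Cobordism K K') (g : ℕ) (_ : IsConnected W.compactPart ∧ W.HasGenus g), (g : ℕ∞)

/-- An upper or lower bound for the pair `(Λ, Λ')` with respect to Lagrangian cobordism: a nonempty
link `M` (Legendrian, being an end of Lagrangian cobordisms), together with two Lagrangian
cobordisms `left`, `right` that realize the bound. -/
inductive LagrangianBound (Λ Λ' : OrientedLink) where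
  | upper (M : OrientedLink) (nonempty : 0 < M.numComponents)
      (left : LagrangianCobordism Λ M) (right : LagrangianCobordism Λ' M)
  | lower (M : OrientedLink) (nonempty : 0 < M.numComponents)
      (left : LagrangianCobordism M Λ) (right : LagrangianCobordism M Λ')

namespace LagrangianBound

variable {Λ Λ' : OrientedLink}

/-- The sum of the Euler characteristics of the two Lagrangians of the bound is `χ`. -/
def HasEulerChar : LagrangianBound Λ Λ' → ℤ → Prop
  | upper _ _ left right, χ =>
      ∃ χ₁ χ₂ : ℤ, left.HasEulerChar χ₁ ∧ right.HasEulerChar χ₂ ∧ χ = χ₁ + χ₂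
  | lower _ _ left right, χ =>
      ∃ χ₁ χ₂ : ℤ, left.HasEulerChar χ₁ ∧ right.HasEulerChar χ₂ ∧ χ = χ₁ + χ₂

/-- The smooth composition of the two Lagrangians, placed in `[2k, 2k + 2] × ℝ³` and running from
`Λ` at the bottom to `Λ'` at the top: the right one of an upper bound and the left one of a lower
bound are reversed. -/
def composite : LagrangianBound Λ Λ' → ℕ → Set Space4
  | upper _ _ left right, k => left.stacked (2 * k) ∪ right.stackedReversed (2 * k + 1)
  | lower _ _ left right, k => left.stackedReversed (2 * k) ∪ right.stacked (2 * k + 1)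

end LagrangianBound

/-- A Lagrangian quasi-cobordism between `Λ` and `Λ'`: links `Λ = Λ_0, …, Λ_n = Λ'`, with `n ≥ 1`,
and an upper or lower bound, realized by Lagrangian cobordisms, for each pair of consecutive links.
(All links that occur are Legendrian, being ends of Lagrangian cobordisms.) -/
structure LagrangianQuasiCobordism (Λ Λ' : OrientedLink) where
  length : ℕ
  length_pos : 0 < length
  link : Fin (length + 1) → OrientedLink
  link_first : link 0 = Λ
  link_last : link (Fin.last length) = Λ'
  bound : ∀ i : Fin length, LagrangianBound (link i.castSucc) (link i.succ)

namespace LagrangianQuasiCobordism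

variable {Λ Λ' : OrientedLink}

/-- The Euler characteristic of a quasi-cobordism: the sum of the Euler characteristics of all its
Lagrangians. -/
def HasEulerChar (Q : LagrangianQuasiCobordism Λ Λ') (χ : ℤ) : Prop :=
  ∃ e : Fin Q.length → ℤ, (∀ i, (Q.bound i).HasEulerChar (e i)) ∧ χ = ∑ i, e i

/-- The surface composed of all Lagrangians of the quasi-cobordism, running from `Λ` to `Λ'`. -/
def composite (Q : LagrangianQuasiCobordism Λ Λ') : Set Space4 :=
  ⋃ i : Fin Q.length, (Q.bound i).composite i

/-- The quasi-cobordism `Q` has genus `g`; the genus is determined by the Euler characteristic of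
`Q`, together with the numbers of components and of boundary circles of the composite surface. -/
def HasGenus (Q : LagrangianQuasiCobordism Λ Λ') (g : ℕ) : Prop :=
  ∃ χ : ℤ, Q.HasEulerChar χ ∧
    GenusRelation (numConnectedComponents Q.composite) (Λ.numComponents + Λ'.numComponents) χ g

end LagrangianQuasiCobordism

/-- The relative Lagrangian genus: the minimal genus of all Lagrangian quasi-cobordisms between `Λ`
and `Λ'` (`⊤` if there is none). -/
noncomputable def relativeLagrangianGenus (Λ Λ' : OrientedLink) : ℕ∞ :=
  ⨅ (Q : LagrangianQuasiCobordism Λ Λ') (g : ℕ) (_ : Q.HasGenus g), (g : ℕ∞)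

/-- The minimal genus of the Lagrangian quasi-cobordisms between `Λ` and `Λ'` whose composite
surface is connected (`⊤` if there is none). -/
noncomputable def connectedRelativeLagrangianGenus (Λ Λ' : OrientedLink) : ℕ∞ :=
  ⨅ (Q : LagrangianQuasiCobordism Λ Λ') (g : ℕ) (_ : IsConnected Q.composite ∧ Q.HasGenus g),
    (g : ℕ∞)

end LegCob

/-! Every quasi-cobordism of genus `g` yields a smooth cobordism of genus `g` whose compact part is
exactly the composite surface; both inequalities between infima follow at once. Once the Lagrangian
condition is forgotten, each piece may be turned upside down (`Cobordism.reversed`) and moved by an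
affine change of `t` into its own slab (`Cobordism.exists_stacked`). Consecutive pieces then overlap
in a cylinder over their common link and can be glued (`Cobordism.glue`). Smoothness is local. For
the orientation, the two given forms are interpolated along the cylinder; both are positive on the
product basis, so a convex combination of them never vanishes on the tangent plane.

What remains is bookkeeping for the genus. The composite and the compact part of the new cobordism
are the same set, so the number of components agrees, and so does the number of boundary circles.
The Euler characteristic must be shown to be additive. It is defined by the existence of some finite
cell decomposition, and the decompositions of two neighbouring pieces need not match along the
common link. The collar between them resolves this: each annulus is cut along one path from a vertex
below to a vertex above, which adds one edge and one face and hence contributes zero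
(`exists_isCellDecomposition_collar`). To make such constructions possible, CW complexes are
replaced by plain families of open cells (`hasEulerCharacteristic_iff`). -/

namespace LegCob

open Set Metric Topology

/-! ### Finite cell decompositions as families of open cells -/

section Cells

variable {X : Type*} [TopologicalSpace X]

/-- The set `e` is an open `n`-cell whose boundary is attached to `S`. -/
def IsCell (S : Set X) (n : ℕ) (e : Set X) : Prop :=
  ∃ φ : (Fin n → ℝ) → X, ContinuousOn φ (closedBall 0 1) ∧ InjOn φ (ball 0 1) ∧
    φ '' ball 0 1 = e ∧ MapsTo φ (sphere 0 1) S

/-- The union of the cells of dimension less than `n` of a family of cells. -/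
def skeletonBelow (E : ℕ → Set (Set X)) (n : ℕ) : Set X := {x | ∃ m < n, ∃ e ∈ E m, x ∈ e}

/-- `E n` is the set of open `n`-cells of a finite cell decomposition of `A` of dimension at
most two. -/
structure IsCellDecomposition (E : ℕ → Set (Set X)) (A : Set X) : Prop where
  finite : ∀ n, (E n).Finite
  dim_le_two : ∀ n, ∀ e ∈ E n, n ≤ 2
  isCell : ∀ n, ∀ e ∈ E n, IsCell (skeletonBelow E n) n e
  eq_of_mem : ∀ n m, ∀ e ∈ E n, ∀ f ∈ E m, ∀ x ∈ e, x ∈ f → n = m ∧ e = f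
  mem_iff : ∀ x, x ∈ A ↔ ∃ n, ∃ e ∈ E n, x ∈ e

/-- The alternating sum of the numbers of cells. -/
noncomputable def cellCount (E : ℕ → Set (Set X)) : ℤ :=
  (E 0).ncard - (E 1).ncard + (E 2).ncard

/-- `B` is a union of vertices and edges. -/
def IsUnionOfCells (E : ℕ → Set (Set X)) (B : Set X) : Prop :=
  ∀ x ∈ B, ∃ n ≤ 1, ∃ e ∈ E n, x ∈ e ∧ e ⊆ B

/-- Closed subsets of the compact `K` have closed images; `hd` says that no point of `K` outside `U`
lands in `φ '' U`, so intersecting such an image with `φ '' U` gives the required preimage. This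
supplies the continuity of the inverse of a characteristic map, which `IsCell` does not record. -/
theorem continuousOn_leftInverse_image {Y : Type*} [TopologicalSpace Y] [T2Space X] {φ : Y → X}
    {ψ : X → Y} {U K : Set Y} (hK : IsCompact K) (hUK : U ⊆ K) (hφ : ContinuousOn φ K)
    (hψ : LeftInvOn ψ φ U) (hd : ∀ x ∈ K, φ x ∈ φ '' U → x ∈ U) :
    ContinuousOn ψ (φ '' U) := by
  rw [continuousOn_iff_isClosed]
  intro Z hZ
  refine ⟨φ '' (K ∩ Z), ((hK.inter_right hZ).image_of_continuousOn
    (hφ.mono inter_subset_left)).isClosed, ?_⟩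
  ext y
  constructor
  · rintro ⟨hy, x, hx, rfl⟩
    rw [mem_preimage, hψ hx] at hy
    exact ⟨⟨x, ⟨hUK hx, hy⟩, rfl⟩, x, hx, rfl⟩
  · rintro ⟨⟨x, ⟨hxK, hxZ⟩, rfl⟩, h⟩
    refine ⟨?_, h⟩
    rw [mem_preimage, hψ (hd x hxK h)]
    exact hxZ

theorem IsCell.mono {S T : Set X} {n : ℕ} {e : Set X} (h : IsCell S n e) (hST : S ⊆ T) :
    IsCell T n e := by
  obtain ⟨φ, h1, h2, h3, h4⟩ := h
  exact ⟨φ, h1, h2, h3, fun x hx => hST (h4 hx)⟩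

theorem IsCell.nonempty {S : Set X} {n : ℕ} {e : Set X} (h : IsCell S n e) : e.Nonempty := by
  obtain ⟨φ, h1, h2, h3, h4⟩ := h
  exact h3 ▸ ⟨φ 0, 0, by simp, rfl⟩

theorem IsCell.isPreconnected {S : Set X} {n : ℕ} {e : Set X} (h : IsCell S n e) :
    IsPreconnected e := by
  obtain ⟨φ, h1, h2, rfl, h4⟩ := h
  exact (convex_ball _ _).isPreconnected.image _ (h1.mono ball_subset_closedBall)

theorem IsCell.image {Y : Type*} [TopologicalSpace Y] {S : Set X} {n : ℕ} {e : Set X}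
    (h : IsCell S n e) {f : X → Y} (hf : Continuous f) (hi : Function.Injective f) :
    IsCell (f '' S) n (f '' e) := by
  obtain ⟨φ, h1, h2, rfl, h4⟩ := h
  exact ⟨f ∘ φ, hf.comp_continuousOn h1, fun x hx y hy hxy => h2 hx hy (hi hxy),
    by rw [image_comp], fun x hx => ⟨_, h4 hx, rfl⟩⟩

theorem IsCell.exists_eq_singleton {S : Set X} {e : Set X} (h : IsCell S 0 e) :
    ∃ x, e = {x} := by
  obtain ⟨φ, h1, h2, rfl, h4⟩ := h
  refine ⟨φ 0, ?_⟩
  ext x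
  constructor
  · rintro ⟨y, -, rfl⟩
    rw [Subsingleton.elim y 0]; rfl
  · rintro rfl
    exact ⟨0, by simp, rfl⟩

theorem isCell_zero (S : Set X) (x : X) : IsCell S 0 {x} := by
  refine ⟨fun _ => x, continuousOn_const, fun a _ b _ _ => Subsingleton.elim a b, ?_, ?_⟩
  · ext y
    constructor
    · rintro ⟨_, -, rfl⟩; rfl
    · rintro rfl
      exact ⟨0, by simp, rfl⟩
  · intro y hy
    rw [Subsingleton.elim y 0, mem_sphere, dist_self] at hy
    exact absurd hy zero_ne_one

/-- An endpoint of the edge: the open interval is dense in the closed one, so its endpoints are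
mapped into the closure. -/
theorem IsCell.exists_mem_closure {S : Set X} {e : Set X} (h : IsCell S 1 e) :
    ∃ x ∈ S, x ∈ closure e := by
  obtain ⟨φ, h1, h2, rfl, h4⟩ := h
  have hs : (fun _ => 1 : Fin 1 → ℝ) ∈ sphere (0 : Fin 1 → ℝ) 1 := by simp
  refine ⟨φ fun _ => 1, h4 hs, ?_⟩
  have hc : closure (ball (0 : Fin 1 → ℝ) 1) = closedBall 0 1 := closure_ball _ one_ne_zero
  exact (hc ▸ h1).image_closure ⟨_, hc ▸ sphere_subset_closedBall hs, rfl⟩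

theorem mem_ball_pi {n : ℕ} (x : Fin n → ℝ) :
    x ∈ ball (0 : Fin n → ℝ) 1 ↔ ∀ i, (x i + 1) / 2 ∈ Ioo (0 : ℝ) 1 := by
  rw [mem_ball, dist_pi_lt_iff one_pos]
  refine forall_congr' fun i => ?_
  rw [Pi.zero_apply, Real.dist_0_eq_abs, abs_lt, mem_Ioo]
  constructor <;> rintro ⟨h1, h2⟩ <;> constructor <;> linarith

theorem mem_closedBall_pi {n : ℕ} (x : Fin n → ℝ) :
    x ∈ closedBall (0 : Fin n → ℝ) 1 ↔ ∀ i, (x i + 1) / 2 ∈ Icc (0 : ℝ) 1 := by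
  rw [mem_closedBall, dist_pi_le_iff zero_le_one]
  refine forall_congr' fun i => ?_
  rw [Pi.zero_apply, Real.dist_0_eq_abs, abs_le, mem_Icc]
  constructor <;> rintro ⟨h1, h2⟩ <;> constructor <;> linarith

/-- Cells may be parametrized by the unit cube. -/
theorem isCell_of_cube {S : Set X} {n : ℕ} (f : (Fin n → ℝ) → X) (hf : Continuous f)
    (hi : InjOn f {x | ∀ i, x i ∈ Ioo (0 : ℝ) 1})
    (hb : ∀ x, (∀ i, x i ∈ Icc (0 : ℝ) 1) → (∃ i, x i = 0 ∨ x i = 1) → f x ∈ S) :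
    IsCell S n (f '' {x | ∀ i, x i ∈ Ioo (0 : ℝ) 1}) := by
  refine ⟨fun x => f fun i => (x i + 1) / 2, ?_, ?_, ?_, ?_⟩
  · exact (hf.comp (by fun_prop)).continuousOn
  · intro x hx y hy hxy
    rw [mem_ball_pi] at hx hy
    have := hi hx hy hxy
    funext i
    have := congrFun this i
    change (x i + 1) / 2 = (y i + 1) / 2 at this
    linarith
  · ext p
    constructor
    · rintro ⟨x, hx, rfl⟩
      exact ⟨_, (mem_ball_pi x).1 hx, rfl⟩
    · rintro ⟨x, hx, rfl⟩
      refine ⟨fun i => 2 * x i - 1, ?_, ?_⟩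
      · rw [mem_ball_pi]
        intro i
        convert hx i using 1
        ring
      · exact congrArg f (funext fun i => by ring)
  · intro x hx
    have h1 := (mem_closedBall_pi x).1 (sphere_subset_closedBall hx)
    have h2 : x ∉ ball (0 : Fin n → ℝ) 1 := fun h => by
      rw [mem_ball] at h; rw [mem_sphere] at hx; linarith
    rw [mem_ball_pi] at h2
    push Not at h2
    obtain ⟨i, hi⟩ := h2
    refine hb _ h1 ⟨i, ?_⟩
    by_contra hc
    push Not at hc
    exact hi ⟨lt_of_le_of_ne (h1 i).1 (Ne.symm hc.1), lt_of_le_of_ne (h1 i).2 hc.2⟩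

theorem isCell_one {S : Set X} (γ : ℝ → X) (hγ : Continuous γ) (hi : InjOn γ (Ioo 0 1))
    (h0 : γ 0 ∈ S) (h1 : γ 1 ∈ S) : IsCell S 1 (γ '' Ioo 0 1) := by
  have h := isCell_of_cube (S := S) (n := 1) (fun x => γ (x 0)) (by fun_prop)
    (fun x hx y hy hxy => by
      funext i
      rw [Subsingleton.elim i 0]
      exact hi (hx 0) (hy 0) hxy)
    (by
      rintro x - ⟨i, hi⟩
      rw [Subsingleton.elim i 0] at hi
      rcases hi with hi | hi <;> simpa only [hi])
  convert h using 1
  ext p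
  constructor
  · rintro ⟨s, hs, rfl⟩
    exact ⟨fun _ => s, fun _ => hs, rfl⟩
  · rintro ⟨x, hx, rfl⟩
    exact ⟨x 0, hx 0, rfl⟩

theorem isCell_two {S : Set X} (f : ℝ → ℝ → X) (hf : Continuous fun p : ℝ × ℝ => f p.1 p.2)
    (hi : ∀ s ∈ Ioo (0 : ℝ) 1, ∀ v ∈ Ioo (0 : ℝ) 1, ∀ s' ∈ Ioo (0 : ℝ) 1, ∀ v' ∈ Ioo (0 : ℝ) 1,
      f s v = f s' v' → s = s' ∧ v = v')
    (h0 : ∀ v, f 0 v ∈ S) (h1 : ∀ v, f 1 v ∈ S)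
    (h2 : ∀ s ∈ Icc (0 : ℝ) 1, f s 0 ∈ S) (h3 : ∀ s ∈ Icc (0 : ℝ) 1, f s 1 ∈ S) :
    IsCell S 2 {p | ∃ s ∈ Ioo (0 : ℝ) 1, ∃ v ∈ Ioo (0 : ℝ) 1, p = f s v} := by
  have h := isCell_of_cube (S := S) (n := 2) (fun x => f (x 0) (x 1))
    (hf.comp (f := fun x : Fin 2 → ℝ => (x 0, x 1)) (by fun_prop))
    (fun x hx y hy hxy => by
      obtain ⟨e0, e1⟩ := hi _ (hx 0) _ (hx 1) _ (hy 0) _ (hy 1) hxy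
      funext i
      fin_cases i
      exacts [e0, e1])
    (by
      rintro x hx ⟨i, hi⟩
      fin_cases i
      · rcases hi with hi | hi
        · simpa only [show x 0 = 0 from hi] using h0 _
        · simpa only [show x 0 = 1 from hi] using h1 _
      · rcases hi with hi | hi
        · simpa only [show x 1 = 0 from hi] using h2 _ (hx 0)
        · simpa only [show x 1 = 1 from hi] using h3 _ (hx 0))
  convert h using 1
  ext p
  constructor
  · rintro ⟨s, hs, v, hv, rfl⟩
    refine ⟨![s, v], fun i => ?_, rfl⟩
    fin_cases i
    exacts [hs, hv]
  · rintro ⟨x, hx, rfl⟩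
    exact ⟨x 0, hx 0, x 1, hx 1, rfl⟩

/-- A cell is connected, so it cannot meet both of two disjoint closed sets whose union contains it.
This separates the two ends of a cobordism, and the components of a link. -/
theorem IsCellDecomposition.isUnionOfCells_left {E : ℕ → Set (Set X)} {A B C : Set X}
    (hE : IsCellDecomposition E A) (h : IsUnionOfCells E (B ∪ C)) (hB : IsClosed B)
    (hC : IsClosed C) (hd : Disjoint B C) : IsUnionOfCells E B := by
  intro x hx
  obtain ⟨n, hn, e, he, hxe, hsub⟩ := h x (Or.inl hx)
  refine ⟨n, hn, e, he, hxe, ?_⟩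
  have := (isPreconnected_iff_subset_of_disjoint_closed.1 (hE.isCell n e he).isPreconnected) B C
    hB hC hsub (by rw [hd.inter_eq, inter_empty])
  rcases this with h | h
  · exact h
  · exact (hd.le_bot ⟨hx, h hxe⟩).elim

/-- If the cell through a point of `B` is an edge, then its endpoint is a vertex, which stays in `B`
because `B` is closed. -/
theorem IsCellDecomposition.exists_vertex {E : ℕ → Set (Set X)} {A B : Set X}
    (hE : IsCellDecomposition E A) (h : IsUnionOfCells E B) (hB : IsClosed B)
    (hne : B.Nonempty) : ∃ x ∈ B, {x} ∈ E 0 := by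
  obtain ⟨x, hx⟩ := hne
  obtain ⟨n, hn, e, he, hxe, hsub⟩ := h x hx
  have key : ∀ y ∈ B, ∀ f ∈ E 0, y ∈ f → ∃ x ∈ B, {x} ∈ E 0 := by
    intro y hy f hf hyf
    obtain ⟨z, rfl⟩ := (hE.isCell 0 f hf).exists_eq_singleton
    rw [mem_singleton_iff] at hyf
    exact ⟨z, hyf ▸ hy, hf⟩
  interval_cases n
  · exact key x hx e he hxe
  · obtain ⟨y, ⟨m, hm, f, hf, hyf⟩, hye⟩ := (hE.isCell 1 e he).exists_mem_closure
    obtain rfl : m = 0 := by omega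
    exact key y (hB.closure_subset_iff.2 hsub hye) f hf hyf

/-- The new cells need not form a decomposition of `B` by themselves, since their boundaries may be
attached to cells of `E`. This is needed for open annuli, which are not compact. The counts add
because nonempty cells of disjoint sets are distinct. -/
theorem IsCellDecomposition.extend {E F : ℕ → Set (Set X)} {A B : Set X}
    (hE : IsCellDecomposition E A) (hfin : ∀ n, (F n).Finite) (hdim : ∀ n, ∀ e ∈ F n, n ≤ 2)
    (hcell : ∀ n, ∀ e ∈ F n, IsCell (skeletonBelow (fun k => E k ∪ F k) n) n e)
    (heq : ∀ n m, ∀ e ∈ F n, ∀ f ∈ F m, ∀ x ∈ e, x ∈ f → n = m ∧ e = f)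
    (hmem : ∀ x, x ∈ B ↔ ∃ n, ∃ e ∈ F n, x ∈ e) (hd : Disjoint A B) :
    IsCellDecomposition (fun n => E n ∪ F n) (A ∪ B) ∧
      cellCount (fun n => E n ∪ F n) = cellCount E + cellCount F := by
  have hA : ∀ n, ∀ e ∈ E n, e ⊆ A := fun n e he x hx => (hE.mem_iff x).2 ⟨n, e, he, hx⟩
  have hB : ∀ n, ∀ e ∈ F n, e ⊆ B := fun n e he x hx => (hmem x).2 ⟨n, e, he, hx⟩
  constructor
  · refine ⟨fun n => (hE.finite n).union (hfin n), ?_, ?_, ?_, ?_⟩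
    · rintro n e (he | he)
      exacts [hE.dim_le_two n e he, hdim n e he]
    · rintro n e (he | he)
      · refine (hE.isCell n e he).mono ?_
        rintro x ⟨m, hm, f, hf, hx⟩
        exact ⟨m, hm, f, Or.inl hf, hx⟩
      · exact hcell n e he
    · rintro n m e (he | he) f (hf | hf) x hx hx'
      · exact hE.eq_of_mem n m e he f hf x hx hx'
      · exact (hd.le_bot ⟨hA n e he hx, hB m f hf hx'⟩).elim
      · exact (hd.le_bot ⟨hA m f hf hx', hB n e he hx⟩).elim
      · exact heq n m e he f hf x hx hx'
    · intro x
      rw [mem_union, hE.mem_iff, hmem]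
      constructor
      · rintro (⟨n, e, he, hx⟩ | ⟨n, e, he, hx⟩)
        exacts [⟨n, e, Or.inl he, hx⟩, ⟨n, e, Or.inr he, hx⟩]
      · rintro ⟨n, e, he | he, hx⟩
        exacts [Or.inl ⟨n, e, he, hx⟩, Or.inr ⟨n, e, he, hx⟩]
  · have key : ∀ n, (E n ∪ F n).ncard = (E n).ncard + (F n).ncard := by
      intro n
      refine ncard_union_eq ?_ (hE.finite n) (hfin n)
      rw [Set.disjoint_left]
      intro e he he'
      obtain ⟨x, hx⟩ := (hE.isCell n e he).nonempty
      exact hd.le_bot ⟨hA n e he hx, hB n e he' hx⟩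
    simp only [cellCount, key]
    push_cast
    ring

theorem IsCellDecomposition.union {E F : ℕ → Set (Set X)} {A B : Set X}
    (hE : IsCellDecomposition E A) (hF : IsCellDecomposition F B) (hd : Disjoint A B) :
    IsCellDecomposition (fun n => E n ∪ F n) (A ∪ B) ∧
      cellCount (fun n => E n ∪ F n) = cellCount E + cellCount F := by
  refine hE.extend hF.finite hF.dim_le_two (fun n e he => (hF.isCell n e he).mono ?_)
    hF.eq_of_mem hF.mem_iff hd
  rintro x ⟨m, hm, f, hf, hx⟩
  exact ⟨m, hm, f, Or.inr hf, hx⟩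

theorem IsCellDecomposition.image {Y : Type*} [TopologicalSpace Y] {E : ℕ → Set (Set X)}
    {A : Set X} (hE : IsCellDecomposition E A) {f : X → Y} (hf : Continuous f)
    (hi : Function.Injective f) :
    IsCellDecomposition (fun n => image f '' E n) (f '' A) ∧
      cellCount (fun n => image f '' E n) = cellCount E := by
  constructor
  · refine ⟨fun n => (hE.finite n).image _, ?_, ?_, ?_, ?_⟩
    · rintro n _ ⟨e, he, rfl⟩
      exact hE.dim_le_two n e he
    · rintro n _ ⟨e, he, rfl⟩
      refine ((hE.isCell n e he).image hf hi).mono ?_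
      rintro _ ⟨x, ⟨m, hm, g, hg, hx⟩, rfl⟩
      exact ⟨m, hm, _, ⟨g, hg, rfl⟩, x, hx, rfl⟩
    · rintro n m _ ⟨e, he, rfl⟩ _ ⟨g, hg, rfl⟩ _ ⟨x, hx, rfl⟩ hx'
      obtain ⟨h1, h2⟩ := hE.eq_of_mem n m e he g hg x hx ((hi.mem_set_image).1 hx')
      exact ⟨h1, by rw [h2]⟩
    · intro y
      constructor
      · rintro ⟨x, hx, rfl⟩
        obtain ⟨n, e, he, hxe⟩ := (hE.mem_iff x).1 hx
        exact ⟨n, _, ⟨e, he, rfl⟩, x, hxe, rfl⟩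
      · rintro ⟨n, _, ⟨e, he, rfl⟩, x, hxe, rfl⟩
        exact ⟨x, (hE.mem_iff x).2 ⟨n, e, he, hxe⟩, rfl⟩
  · simp only [cellCount, ncard_image_of_injective _ hi.image_injective]

end Cells

theorem IsUnionOfCells.mono {Z : Type*} {E F : ℕ → Set (Set Z)} {B : Set Z} (h : IsUnionOfCells E B)
    (hEF : ∀ n, E n ⊆ F n) : IsUnionOfCells F B := by
  intro x hx
  obtain ⟨n, hn, e, he, h⟩ := h x hx
  exact ⟨n, hn, e, hEF n he, h⟩

theorem IsUnionOfCells.union {Z : Type*} {E : ℕ → Set (Set Z)} {B C : Set Z} (hB : IsUnionOfCells E B)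
    (hC : IsUnionOfCells E C) : IsUnionOfCells E (B ∪ C) := by
  rintro x (hx | hx)
  · obtain ⟨n, hn, e, he, h, h'⟩ := hB x hx
    exact ⟨n, hn, e, he, h, h'.trans subset_union_left⟩
  · obtain ⟨n, hn, e, he, h, h'⟩ := hC x hx
    exact ⟨n, hn, e, he, h, h'.trans subset_union_right⟩

theorem IsUnionOfCells.image {Y Z : Type*} {E : ℕ → Set (Set Z)} {B : Set Z}
    (h : IsUnionOfCells E B) (f : Z → Y) :
    IsUnionOfCells (fun n => Set.image f '' E n) (f '' B) := by
  rintro _ ⟨x, hx, rfl⟩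
  obtain ⟨n, hn, e, he, hxe, hsub⟩ := h x hx
  exact ⟨n, hn, _, ⟨e, he, rfl⟩, ⟨x, hxe, rfl⟩, image_mono hsub⟩

/-! ### Comparison with CW complexes -/

theorem hasEulerCharacteristic_iff {A B : Set Space4} {χ : ℤ} :
    HasEulerCharacteristic A B χ ↔
      ∃ E, IsCellDecomposition E A ∧ IsUnionOfCells E B ∧ cellCount E = χ := by
  constructor
  · rintro ⟨_, hfin, hdim, ⟨I₀, I₁, hB⟩, rfl⟩
    have hinj : ∀ n, Function.Injective
        (fun i : RelCWComplex.cell A n => RelCWComplex.openCell n i) :=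
      fun n i j h => RelCWComplex.openCell_congr n h
    refine ⟨fun n => range fun i : RelCWComplex.cell A n => RelCWComplex.openCell n i,
      ⟨fun n => @finite_range _ _ _ (hfin n), ?_, ?_, ?_, ?_⟩, ?_, ?_⟩
    · rintro n _ ⟨i, rfl⟩
      by_contra h
      exact (hdim n (not_le.1 h)).false i
    · rintro n _ ⟨i, rfl⟩
      refine ⟨RelCWComplex.map n i, RelCWComplex.continuousOn n i, ?_, rfl, ?_⟩
      · rw [← RelCWComplex.source_eq n i]
        exact (RelCWComplex.map n i).injOn
      · obtain ⟨I, hI⟩ := CWComplex.cellFrontier_subset_finite_openCell n i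
        intro x hx
        have := hI ⟨x, hx, rfl⟩
        simp only [mem_iUnion] at this
        obtain ⟨m, hm, j, -, hj⟩ := this
        exact ⟨m, hm, _, ⟨j, rfl⟩, hj⟩
    · rintro n m _ ⟨i, rfl⟩ _ ⟨j, rfl⟩ x hx hx'
      have := RelCWComplex.eq_of_not_disjoint_openCell (not_disjoint_iff.2 ⟨x, hx, hx'⟩)
      rw [Sigma.mk.injEq] at this
      obtain ⟨rfl, h⟩ := this
      exact ⟨rfl, by rw [eq_of_heq h]⟩
    · intro x
      conv_lhs => rw [← CWComplex.iUnion_openCell_eq_complex (C := A)]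
      simp only [mem_iUnion, mem_range, exists_exists_eq_and]
    · intro x hx
      have hx' := hx
      rw [hB] at hx'
      simp only [mem_union, mem_iUnion] at hx'
      rcases hx' with ⟨i, hi, hxi⟩ | ⟨i, hi, hxi⟩
      · refine ⟨0, zero_le_one, _, ⟨i, rfl⟩, hxi, ?_⟩
        rw [hB]
        exact subset_union_of_subset_left
          (subset_biUnion_of_mem (u := fun i => RelCWComplex.openCell 0 i) hi) _
      · refine ⟨1, le_rfl, _, ⟨i, rfl⟩, hxi, ?_⟩
        rw [hB]
        exact subset_union_of_subset_right
          (subset_biUnion_of_mem (u := fun i => RelCWComplex.openCell 1 i) hi) _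
    · have key : ∀ n, (range fun i : RelCWComplex.cell A n => RelCWComplex.openCell n i).ncard =
          Nat.card (RelCWComplex.cell A n) := fun n => by
        rw [← image_univ, ncard_image_of_injective _ (hinj n), ncard_univ]
      simp only [cellCount, key]
  · rintro ⟨E, hE, hB, rfl⟩
    choose φ hcont hinj himg hmaps using fun n (e : E n) => hE.isCell n e.1 e.2
    have hclosed : ∀ n (e : E n), e.1 ⊆ φ n e '' closedBall 0 1 := fun n e => by
      conv_lhs => rw [← himg n e]
      exact image_mono ball_subset_closedBall
    let cw : CWComplex A := CWComplex.mkFinite A (fun n => E n)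
      (fun n e => (hinj n e).toPartialEquiv (φ n e) (ball 0 1))
      (Filter.eventually_atTop.2 ⟨3, fun n hn => ⟨fun e => by
        have := hE.dim_le_two n e.1 e.2
        omega⟩⟩)
      (fun n => (hE.finite n).to_subtype)
      (fun n e => rfl)
      (fun n e => hcont n e)
      (fun n e => by
        refine continuousOn_leftInverse_image (isCompact_closedBall _ _) ball_subset_closedBall
          (hcont n e) ((hinj n e).toPartialEquiv (φ n e) (ball 0 1)).left_inv' ?_
        -- A point of the closed ball that is mapped into the open cell is interior: the sphere goes
        -- to cells of smaller dimension, which are disjoint from this one.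
        intro x hx hx'
        rw [himg] at hx'
        by_contra hxb
        have hs : x ∈ sphere (0 : Fin n → ℝ) 1 := by
          rw [← closedBall_sdiff_ball]
          exact ⟨hx, hxb⟩
        obtain ⟨m, hm, f, hf, hxf⟩ := hmaps n e hs
        have := (hE.eq_of_mem n m e.1 e.2 f hf _ hx' hxf).1
        omega)
      (by
        rintro ⟨n, e⟩ - ⟨m, f⟩ - hne
        refine Set.disjoint_left.2 fun x hx hx' => hne ?_
        replace hx : x ∈ φ n e '' ball 0 1 := hx
        replace hx' : x ∈ φ m f '' ball 0 1 := hx'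
        rw [himg] at hx hx'
        obtain ⟨rfl, h⟩ := hE.eq_of_mem n m e.1 e.2 f.1 f.2 x hx hx'
        rw [Subtype.ext h])
      (fun n e x hx => by
        obtain ⟨m, hm, f, hf, hxf⟩ := hmaps n e hx
        simp only [mem_iUnion]
        exact ⟨m, hm, ⟨f, hf⟩, hclosed m ⟨f, hf⟩ hxf⟩)
      (by
        ext x
        simp only [mem_iUnion]
        constructor
        · rintro ⟨n, e, y, hy, rfl⟩
          rw [← sphere_union_ball] at hy
          rw [hE.mem_iff]
          rcases hy with hy | hy
          · obtain ⟨m, hm, f, hf, hxf⟩ := hmaps n e hy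
            exact ⟨m, f, hf, hxf⟩
          · exact ⟨n, e.1, e.2, himg n e ▸ ⟨y, hy, rfl⟩⟩
        · intro hx
          obtain ⟨n, e, he, hxe⟩ := (hE.mem_iff x).1 hx
          exact ⟨n, ⟨e, he⟩, hclosed n ⟨e, he⟩ hxe⟩)
    have hopen : ∀ n (e : E n), RelCWComplex.openCell (C := A) n e = e.1 := fun n e => himg n e
    refine ⟨cw, fun n => (hE.finite n).to_subtype, fun n hn => ⟨fun e => ?_⟩,
      ⟨{e | (e : E 0).1 ⊆ B}, {e | (e : E 1).1 ⊆ B}, ?_⟩, ?_⟩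
    · have := hE.dim_le_two n (e : E n).1 (e : E n).2
      omega
    · ext x
      simp only [mem_union, mem_iUnion]
      constructor
      · intro hx
        obtain ⟨n, hn, e, he, hxe, hsub⟩ := hB x hx
        interval_cases n
        · exact Or.inl ⟨⟨e, he⟩, hsub, (hopen 0 ⟨e, he⟩).symm ▸ hxe⟩
        · exact Or.inr ⟨⟨e, he⟩, hsub, (hopen 1 ⟨e, he⟩).symm ▸ hxe⟩
      · rintro (⟨e, he, hx⟩ | ⟨e, he, hx⟩)
        · exact he ((hopen 0 e) ▸ hx)
        · exact he ((hopen 1 e) ▸ hx)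
    · rfl

theorem ncard_range_of_mem {ι X : Type*} [Finite ι] {F : ι → Set X} (hne : ∀ i, (F i).Nonempty)
    (h : ∀ i j, ∀ x ∈ F i, x ∈ F j → i = j) : (Set.range F).ncard = Nat.card ι := by
  rw [← image_univ, ncard_image_of_injective, ncard_univ]
  intro i j hij
  obtain ⟨x, hx⟩ := hne i
  exact h i j x hx (hij ▸ hx)

/-! ### Cells of slices and collars over a link -/

namespace OrientedLink

variable (K : OrientedLink)

theorem continuous_curve (i : Fin K.numComponents) : Continuous (K.curve i) :=
  (K.smooth i).continuous

theorem curve_mem_range (i : Fin K.numComponents) (s : ℝ) : K.curve i s ∈ K.range :=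
  mem_iUnion.2 ⟨i, s, rfl⟩

/-- The component `i` is cut open at the parameter `a i`, so that `[a i, a i + 1)` is a fundamental
domain. Slices use `a = 0`; in collars the cutting point moves with the height. -/
theorem exists_eq_curve_add (a : Fin K.numComponents → ℝ) {p : Space3} (hp : p ∈ K.range) :
    ∃ i, ∃ v ∈ Ico (0 : ℝ) 1, p = K.curve i (a i + v) := by
  obtain ⟨i, s, rfl⟩ := mem_iUnion.1 hp
  refine ⟨i, Int.fract (s - a i), ⟨Int.fract_nonneg _, Int.fract_lt_one _⟩, ?_⟩
  rw [Int.fract, show a i + (s - a i - ⌊s - a i⌋) = s - ⌊s - a i⌋ * 1 by ring]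
  exact ((K.periodic i).sub_int_mul_eq _).symm

theorem eq_of_curve_add_eq (a : Fin K.numComponents → ℝ) {i j : Fin K.numComponents} {v w : ℝ}
    (hv : v ∈ Ico (0 : ℝ) 1) (hw : w ∈ Ico (0 : ℝ) 1)
    (h : K.curve i (a i + v) = K.curve j (a j + w)) : i = j ∧ v = w := by
  obtain ⟨rfl, k, hk⟩ := K.injective _ _ _ _ h
  refine ⟨rfl, ?_⟩
  have h1 : (k : ℝ) = v - w := by linarith
  have h2 : (k : ℝ) < 1 := by rw [h1]; linarith [hv.2, hw.1]
  have h3 : (-1 : ℝ) < k := by rw [h1]; linarith [hv.1, hw.2]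
  have h4 : k < 1 := by exact_mod_cast h2
  have h5 : -1 < k := by exact_mod_cast h3
  obtain rfl : k = 0 := by omega
  simpa using hk

theorem isCompact_range_curve (i : Fin K.numComponents) : IsCompact (Set.range (K.curve i)) := by
  have : Set.range (K.curve i) = K.curve i '' Icc 0 1 := by
    refine subset_antisymm ?_ (image_subset_range _ _)
    rintro _ ⟨s, rfl⟩
    refine ⟨Int.fract s, ⟨Int.fract_nonneg _, (Int.fract_lt_one _).le⟩, ?_⟩
    rw [Int.fract, show s - ⌊s⌋ = s - ⌊s⌋ * 1 by ring]
    exact (K.periodic i).sub_int_mul_eq _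
  rw [this]
  exact isCompact_Icc.image (K.continuous_curve i)

theorem isCompact_range : IsCompact K.range :=
  isCompact_iUnion K.isCompact_range_curve

/-- The cells of a decomposition of `{t} × K` with one vertex and one edge on each component. -/
def sliceCells (t : ℝ) : ℕ → Set (Set Space4)
  | 0 => Set.range fun i => {(t, K.curve i 0)}
  | 1 => Set.range fun i => (fun s => (t, K.curve i s)) '' Ioo 0 1
  | _ => ∅

theorem isCellDecomposition_sliceCells (t : ℝ) :
    IsCellDecomposition (K.sliceCells t) ({t} ×ˢ K.range) := by
  have hI : ∀ {v : ℝ}, v ∈ Ioo (0 : ℝ) 1 → v ∈ Ico (0 : ℝ) 1 := fun hv => ⟨hv.1.le, hv.2⟩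
  have h0 : (0 : ℝ) ∈ Ico (0 : ℝ) 1 := ⟨le_rfl, one_pos⟩
  have hinj : ∀ {i j v w}, v ∈ Ico (0 : ℝ) 1 → w ∈ Ico (0 : ℝ) 1 →
      K.curve i v = K.curve j w → i = j ∧ v = w := fun hv hw h =>
    K.eq_of_curve_add_eq (fun _ => 0) hv hw (by simpa using h)
  refine ⟨?_, ?_, ?_, ?_, ?_⟩
  · rintro (_ | _ | n)
    exacts [finite_range _, finite_range _, finite_empty]
  · rintro (_ | _ | n) e he
    exacts [by omega, by omega, he.elim]
  · rintro (_ | _ | n) e he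
    · obtain ⟨i, rfl⟩ := he
      exact isCell_zero _ _
    · obtain ⟨i, rfl⟩ := he
      have hv : (t, K.curve i 0) ∈ skeletonBelow (K.sliceCells t) 1 :=
        ⟨0, zero_lt_one, _, ⟨i, rfl⟩, rfl⟩
      refine isCell_one _ (continuous_const.prodMk (K.continuous_curve i)) ?_ hv ?_
      · intro v hv w hw h
        exact (hinj (hI hv) (hI hw) (Prod.mk.inj h).2).2
      · have := K.periodic i 0
        rw [zero_add] at this
        simpa only [this] using hv
    · exact he.elim
  · rintro (_ | _ | n) (_ | _ | m) e he f hf x hx hx'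
    all_goals first
      | exact he.elim
      | exact hf.elim
      | skip
    · obtain ⟨i, rfl⟩ := he
      obtain ⟨j, rfl⟩ := hf
      rw [mem_singleton_iff] at hx hx'
      obtain ⟨rfl, -⟩ := hinj h0 h0 (Prod.mk.inj (hx.symm.trans hx')).2
      exact ⟨rfl, rfl⟩
    · obtain ⟨i, rfl⟩ := he
      obtain ⟨j, rfl⟩ := hf
      obtain ⟨s, hs, rfl⟩ := hx'
      rw [mem_singleton_iff] at hx
      exact (hs.1.ne' (hinj (hI hs) h0 (Prod.mk.inj hx).2).2).elim
    · obtain ⟨i, rfl⟩ := he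
      obtain ⟨j, rfl⟩ := hf
      obtain ⟨s, hs, rfl⟩ := hx
      rw [mem_singleton_iff] at hx'
      exact (hs.1.ne' (hinj (hI hs) h0 (Prod.mk.inj hx').2).2).elim
    · obtain ⟨i, rfl⟩ := he
      obtain ⟨j, rfl⟩ := hf
      obtain ⟨s, hs, rfl⟩ := hx
      obtain ⟨s', hs', h⟩ := hx'
      obtain ⟨rfl, -⟩ := hinj (hI hs) (hI hs') (Prod.mk.inj h).2.symm
      exact ⟨rfl, rfl⟩
  · rintro ⟨τ, p⟩
    constructor
    · rintro ⟨rfl, hp⟩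
      obtain ⟨i, v, hv, rfl⟩ := K.exists_eq_curve_add (fun _ => 0) hp
      rcases hv.1.eq_or_lt with rfl | hv0
      · exact ⟨0, _, ⟨i, rfl⟩, by simp⟩
      · exact ⟨1, _, ⟨i, rfl⟩, v, ⟨hv0, hv.2⟩, by simp⟩
    · rintro ⟨_ | _ | n, e, he, hx⟩
      · obtain ⟨i, rfl⟩ := he
        obtain ⟨rfl, rfl⟩ := Prod.mk.inj hx
        exact ⟨rfl, K.curve_mem_range _ _⟩
      · obtain ⟨i, rfl⟩ := he
        obtain ⟨s, hs, h⟩ := hx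
        obtain ⟨rfl, rfl⟩ := Prod.mk.inj h
        exact ⟨rfl, K.curve_mem_range _ _⟩
      · exact he.elim

theorem isUnionOfCells_sliceCells (t : ℝ) :
    IsUnionOfCells (K.sliceCells t) ({t} ×ˢ K.range) := by
  have hE := K.isCellDecomposition_sliceCells t
  intro x hx
  obtain ⟨n, e, he, hxe⟩ := (hE.mem_iff x).1 hx
  refine ⟨n, ?_, e, he, hxe, fun y hy => (hE.mem_iff y).2 ⟨n, e, he, hy⟩⟩
  rcases n with _ | _ | n
  exacts [by omega, by omega, he.elim]

theorem cellCount_sliceCells (t : ℝ) : cellCount (K.sliceCells t) = 0 := by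
  have h0 : (K.sliceCells t 0).ncard = Nat.card (Fin K.numComponents) := by
    refine ncard_range_of_mem (fun i => singleton_nonempty _) ?_
    intro i j x hx hx'
    exact (K.injective _ _ _ _ (Prod.mk.inj (hx.symm.trans hx')).2).1
  have h1 : (K.sliceCells t 1).ncard = Nat.card (Fin K.numComponents) := by
    refine ncard_range_of_mem (fun i => ⟨_, 1 / 2, by norm_num, rfl⟩) ?_
    rintro i j _ ⟨s, hs, rfl⟩ ⟨s', hs', h⟩
    exact (K.injective _ _ _ _ (Prod.mk.inj h).2).1.symm
  rw [cellCount, h0, h1, show K.sliceCells t 2 = ∅ from rfl]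
  simp

/-- The cells of the open annuli `(t₁, t₂) × K` cut along paths from `(t₁, K.curve i (a i))` to
`(t₂, K.curve i (b i))`. -/
def collarCells (t₁ t₂ : ℝ) (a b : Fin K.numComponents → ℝ) : ℕ → Set (Set Space4)
  | 1 => Set.range fun i =>
      (fun s => (t₁ + (t₂ - t₁) * s, K.curve i (a i + (b i - a i) * s))) '' Ioo 0 1
  | 2 => Set.range fun i => {p | ∃ s ∈ Ioo (0 : ℝ) 1, ∃ v ∈ Ioo (0 : ℝ) 1,
      p = (t₁ + (t₂ - t₁) * s, K.curve i (a i + (b i - a i) * s + v))}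
  | _ => ∅

/-- No compatibility between `E` and `F` along `K` is needed. Each open annulus is cut along a path
from a vertex of `E` to a vertex of `F`; the complement of the path is an open square whose sides
run along the bottom circle, the top circle and twice along the path. -/
theorem exists_isCellDecomposition_collar {E F : ℕ → Set (Set Space4)} {A₁ A₂ : Set Space4}
    {t₁ t₂ : ℝ} (ht : t₁ < t₂) (hE : IsCellDecomposition E A₁)
    (hEK : IsUnionOfCells E ({t₁} ×ˢ K.range)) (hF : IsCellDecomposition F A₂)
    (hFK : IsUnionOfCells F ({t₂} ×ˢ K.range)) (hA₁ : ∀ q ∈ A₁, q.1 ≤ t₁)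
    (hA₂ : ∀ q ∈ A₂, t₂ ≤ q.1) :
    ∃ G, IsCellDecomposition G (A₁ ∪ A₂ ∪ Ioo t₁ t₂ ×ˢ K.range) ∧ (∀ n, E n ⊆ G n) ∧
      (∀ n, F n ⊆ G n) ∧ cellCount G = cellCount E + cellCount F := by
  -- Every component carries a vertex: it is closed, and so is the union of the other components,
  -- hence it is itself a union of cells.
  have vertex : ∀ {E : ℕ → Set (Set Space4)} {A : Set Space4} {t : ℝ}, IsCellDecomposition E A →
      IsUnionOfCells E ({t} ×ˢ K.range) → ∀ i, ∃ a, {(t, K.curve i a)} ∈ E 0 := by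
    intro E A t hE hEK i
    have hu : ({t} : Set ℝ) ×ˢ K.range =
        {t} ×ˢ Set.range (K.curve i) ∪ {t} ×ˢ ⋃ j : {j // j ≠ i}, Set.range (K.curve j) := by
      rw [← prod_union]
      congr 1
      ext x
      simp only [OrientedLink.range, mem_iUnion, mem_union]
      constructor
      · rintro ⟨j, hj⟩
        by_cases h : j = i
        · exact Or.inl (h ▸ hj)
        · exact Or.inr ⟨⟨j, h⟩, hj⟩
      · rintro (h | ⟨j, hj⟩)
        exacts [⟨i, h⟩, ⟨j, hj⟩]
    have hcl : IsClosed (({t} : Set ℝ) ×ˢ Set.range (K.curve i)) :=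
      isClosed_singleton.prod (K.isCompact_range_curve i).isClosed
    rw [hu] at hEK
    have := hE.isUnionOfCells_left hEK hcl (isClosed_singleton.prod
      (isClosed_iUnion_of_finite fun j => (K.isCompact_range_curve j).isClosed)) ?_
    · obtain ⟨⟨τ, x⟩, ⟨hτ, s, hs⟩, hx'⟩ := hE.exists_vertex this hcl ⟨(t, K.curve i 0), rfl, 0, rfl⟩
      obtain rfl : τ = t := hτ
      obtain rfl : K.curve i s = x := hs
      exact ⟨s, hx'⟩
    · rw [Set.disjoint_left]
      rintro ⟨τ, x⟩ ⟨-, s, hs⟩ ⟨-, h⟩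
      obtain ⟨⟨j, hj⟩, s', hs'⟩ := mem_iUnion.1 h
      exact hj (K.injective _ _ _ _ (hs'.trans hs.symm)).1
  choose a ha using vertex hE hEK
  choose b hb using vertex hF hFK
  have hI : ∀ {v : ℝ}, v ∈ Ioo (0 : ℝ) 1 → v ∈ Ico (0 : ℝ) 1 := fun hv => ⟨hv.1.le, hv.2⟩
  have h0 : (0 : ℝ) ∈ Ico (0 : ℝ) 1 := ⟨le_rfl, one_pos⟩
  have hδ : 0 < t₂ - t₁ := sub_pos.2 ht
  have hinj : ∀ {i j s s' v w}, v ∈ Ico (0 : ℝ) 1 → w ∈ Ico (0 : ℝ) 1 →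
      (t₁ + (t₂ - t₁) * s, K.curve i (a i + (b i - a i) * s + v)) =
        (t₁ + (t₂ - t₁) * s', K.curve j (a j + (b j - a j) * s' + w)) →
      s = s' ∧ i = j ∧ v = w := by
    intro i j s s' v w hv hw h
    obtain ⟨h1, h2⟩ := Prod.mk.inj h
    obtain rfl : s = s' := mul_left_cancel₀ hδ.ne' (add_left_cancel h1)
    exact ⟨rfl, K.eq_of_curve_add_eq (fun i => a i + (b i - a i) * s) hv hw h2⟩
  have hinj' : ∀ {i j s s' w}, w ∈ Ico (0 : ℝ) 1 →
      (t₁ + (t₂ - t₁) * s, K.curve i (a i + (b i - a i) * s)) =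
        (t₁ + (t₂ - t₁) * s', K.curve j (a j + (b j - a j) * s' + w)) →
      s = s' ∧ i = j ∧ 0 = w := by
    intro i j s s' w hw h
    refine hinj (i := i) h0 hw ?_
    rwa [add_zero]
  have hinj'' : ∀ {i j s s'},
      (t₁ + (t₂ - t₁) * s, K.curve i (a i + (b i - a i) * s)) =
        (t₁ + (t₂ - t₁) * s', K.curve j (a j + (b j - a j) * s')) → s = s' ∧ i = j := by
    intro i j s s' h
    obtain ⟨h1, h2, -⟩ := hinj' (i := i) (j := j) h0 (h.trans (by rw [add_zero]))
    exact ⟨h1, h2⟩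
  have hd : Disjoint A₁ A₂ := Set.disjoint_left.2 fun q h1 h2 => by
    linarith [hA₁ q h1, hA₂ q h2]
  have hd' : Disjoint (A₁ ∪ A₂) (Ioo t₁ t₂ ×ˢ K.range) := Set.disjoint_left.2 fun q h1 h2 => by
    rcases h1 with h1 | h1
    · linarith [hA₁ q h1, h2.1.1]
    · linarith [hA₂ q h1, h2.1.2]
  obtain ⟨hU, hUc⟩ := hE.union hF hd
  have hext := hU.extend (F := K.collarCells t₁ t₂ a b) (B := Ioo t₁ t₂ ×ˢ K.range)
    ?_ ?_ ?_ ?_ ?_ hd'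
  · obtain ⟨hG, hGc⟩ := hext
    refine ⟨_, hG, fun n e he => Or.inl (Or.inl he), fun n e he => Or.inl (Or.inr he), ?_⟩
    -- The collar has as many edges as faces, namely one per component, and no vertices.
    rw [hGc, hUc, add_eq_left]
    have h1 : (K.collarCells t₁ t₂ a b 1).ncard = Nat.card (Fin K.numComponents) := by
      refine ncard_range_of_mem (fun i => ⟨_, 1 / 2, by norm_num, rfl⟩) ?_
      rintro i j _ ⟨s, hs, rfl⟩ ⟨s', hs', h⟩
      exact (hinj'' h).2.symm
    have h2 : (K.collarCells t₁ t₂ a b 2).ncard = Nat.card (Fin K.numComponents) := by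
      refine ncard_range_of_mem
        (fun i => ⟨_, 1 / 2, by norm_num, 1 / 2, by norm_num, rfl⟩) ?_
      rintro i j _ ⟨s, hs, v, hv, rfl⟩ ⟨s', hs', v', hv', h⟩
      exact (hinj (hI hv) (hI hv') h).2.1
    rw [cellCount, h1, h2, show K.collarCells t₁ t₂ a b 0 = ∅ from rfl]
    simp
  · rintro (_ | _ | _ | n)
    exacts [finite_empty, finite_range _, finite_range _, finite_empty]
  · rintro (_ | _ | _ | n) e he
    exacts [by omega, by omega, by omega, he.elim]
  -- An arbitrary point of a bounding circle may lie on an edge, so it is available only for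
  -- attaching faces. The cutting edges must end at the chosen vertices.
  · have bot : ∀ i v m, 1 ≤ m → (t₁, K.curve i v) ∈
        skeletonBelow (fun k => E k ∪ F k ∪ K.collarCells t₁ t₂ a b k) (m + 1) := by
      intro i v m hm
      obtain ⟨n, hn, e, he, hx, -⟩ := hEK (t₁, K.curve i v) ⟨rfl, K.curve_mem_range i v⟩
      exact ⟨n, by omega, e, Or.inl (Or.inl he), hx⟩
    have top : ∀ i v m, 1 ≤ m → (t₂, K.curve i v) ∈
        skeletonBelow (fun k => E k ∪ F k ∪ K.collarCells t₁ t₂ a b k) (m + 1) := by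
      intro i v m hm
      obtain ⟨n, hn, e, he, hx, -⟩ := hFK (t₂, K.curve i v) ⟨rfl, K.curve_mem_range i v⟩
      exact ⟨n, by omega, e, Or.inl (Or.inr he), hx⟩
    rintro (_ | _ | _ | n) e he
    · exact he.elim
    · obtain ⟨i, rfl⟩ := he
      refine isCell_one _ ?_ ?_ ?_ ?_
      · exact (by fun_prop : Continuous fun s => t₁ + (t₂ - t₁) * s).prodMk
          ((K.continuous_curve i).comp (by fun_prop))
      · intro s hs s' hs' h
        exact (hinj'' h).1
      · exact ⟨0, zero_lt_one, _, Or.inl (Or.inl (ha i)), by simp⟩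
      · exact ⟨0, zero_lt_one, _, Or.inl (Or.inr (hb i)), by simp⟩
    · obtain ⟨i, rfl⟩ := he
      have edge : ∀ s ∈ Icc (0 : ℝ) 1, (t₁ + (t₂ - t₁) * s, K.curve i (a i + (b i - a i) * s)) ∈
          skeletonBelow (fun k => E k ∪ F k ∪ K.collarCells t₁ t₂ a b k) 2 := by
        intro s hs
        rcases hs.1.eq_or_lt with rfl | hs0
        · simpa using bot i (a i) 1 le_rfl
        rcases hs.2.eq_or_lt with rfl | hs1
        · simpa using top i (b i) 1 le_rfl
        exact ⟨1, one_lt_two, _, Or.inr ⟨i, rfl⟩, s, ⟨hs0, hs1⟩, rfl⟩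
      refine isCell_two
        (fun s v => (t₁ + (t₂ - t₁) * s, K.curve i (a i + (b i - a i) * s + v))) ?_ ?_ ?_ ?_ ?_ ?_
      · exact (by fun_prop : Continuous fun p : ℝ × ℝ => t₁ + (t₂ - t₁) * p.1).prodMk
          ((K.continuous_curve i).comp
            (by fun_prop : Continuous fun p : ℝ × ℝ => a i + (b i - a i) * p.1 + p.2))
      · intro s hs v hv s' hs' v' hv' h
        obtain ⟨h1, -, h2⟩ := hinj (hI hv) (hI hv') h
        exact ⟨h1, h2⟩
      · intro v
        simpa using bot i (a i + v) 1 le_rfl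
      · intro v
        simpa using top i (b i + v) 1 le_rfl
      · intro s hs
        simpa using edge s hs
      -- The side `v = 1` is the cutting path again, by periodicity of the curve.
      · intro s hs
        have := K.periodic i (a i + (b i - a i) * s)
        simpa only [this] using edge s hs
    · exact he.elim
  · rintro (_ | _ | _ | n) (_ | _ | _ | m) e he f hf x hx hx'
    all_goals first
      | exact he.elim
      | exact hf.elim
      | obtain ⟨i, rfl⟩ := he
        obtain ⟨j, rfl⟩ := hf
    · obtain ⟨s, hs, rfl⟩ := hx
      obtain ⟨s', hs', h⟩ := hx'
      obtain ⟨-, rfl⟩ := hinj'' h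
      exact ⟨rfl, rfl⟩
    · obtain ⟨s, hs, rfl⟩ := hx
      obtain ⟨s', hs', v, hv, h⟩ := hx'
      exact (hv.1.ne (hinj' (hI hv) h).2.2).elim
    · obtain ⟨s, hs, v, hv, rfl⟩ := hx
      obtain ⟨s', hs', h⟩ := hx'
      exact (hv.1.ne (hinj' (hI hv) h).2.2).elim
    · obtain ⟨s, hs, v, hv, rfl⟩ := hx
      obtain ⟨s', hs', v', hv', h⟩ := hx'
      obtain ⟨-, rfl, -⟩ := hinj (hI hv) (hI hv') h
      exact ⟨rfl, rfl⟩
  · rintro ⟨τ, p⟩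
    have htime : ∀ {s : ℝ}, s ∈ Ioo (0 : ℝ) 1 → t₁ + (t₂ - t₁) * s ∈ Ioo t₁ t₂ := by
      intro s hs
      constructor <;> nlinarith [hs.1, hs.2]
    constructor
    · rintro ⟨hτ, hp⟩
      have hs : (τ - t₁) / (t₂ - t₁) ∈ Ioo (0 : ℝ) 1 := by
        rw [mem_Ioo, div_lt_one hδ]
        exact ⟨div_pos (sub_pos.2 hτ.1) hδ, by linarith [hτ.2]⟩
      have hτ' : τ = t₁ + (t₂ - t₁) * ((τ - t₁) / (t₂ - t₁)) := by
        rw [mul_div_cancel₀ _ hδ.ne']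
        ring
      generalize (τ - t₁) / (t₂ - t₁) = s at hs hτ'
      subst hτ'
      obtain ⟨i, v, hv, rfl⟩ := K.exists_eq_curve_add (fun i => a i + (b i - a i) * s) hp
      rcases hv.1.eq_or_lt with rfl | hv0
      · exact ⟨1, _, ⟨i, rfl⟩, s, hs, by simp⟩
      · exact ⟨2, _, ⟨i, rfl⟩, s, hs, v, ⟨hv0, hv.2⟩, rfl⟩
    · rintro ⟨_ | _ | _ | n, e, he, hx⟩
      · exact he.elim
      · obtain ⟨i, rfl⟩ := he
        obtain ⟨s, hs, h⟩ := hx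
        obtain ⟨rfl, rfl⟩ := Prod.mk.inj h
        exact ⟨htime hs, K.curve_mem_range _ _⟩
      · obtain ⟨i, rfl⟩ := he
        obtain ⟨s, hs, v, hv, h⟩ := hx
        obtain ⟨rfl, rfl⟩ := Prod.mk.inj h
        exact ⟨htime hs, K.curve_mem_range _ _⟩
      · exact he.elim

end OrientedLink

/-! ### Additivity and invariance of the Euler characteristic -/

/-- Cell decompositions of two surfaces separated in the `t`-direction are joined along a collar. -/
theorem HasEulerCharacteristic.glue {A₁ A₂ P R : Set Space4} {K : OrientedLink} {t₁ t₂ : ℝ}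
    {χ₁ χ₂ : ℤ} (ht : t₁ < t₂) (h₁ : HasEulerCharacteristic A₁ (P ∪ {t₁} ×ˢ K.range) χ₁)
    (h₂ : HasEulerCharacteristic A₂ ({t₂} ×ˢ K.range ∪ R) χ₂) (hP : IsClosed P) (hR : IsClosed R)
    (hPt : ∀ q ∈ P, q.1 < t₁) (hRt : ∀ q ∈ R, t₂ < q.1)
    (hA₁ : ∀ q ∈ A₁, q.1 ≤ t₁) (hA₂ : ∀ q ∈ A₂, t₂ ≤ q.1) :
    HasEulerCharacteristic (A₁ ∪ A₂ ∪ Ioo t₁ t₂ ×ˢ K.range) (P ∪ R) (χ₁ + χ₂) := by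
  rw [hasEulerCharacteristic_iff] at h₁ h₂ ⊢
  obtain ⟨E, hE, hEB, rfl⟩ := h₁
  obtain ⟨F, hF, hFB, rfl⟩ := h₂
  have hK : ∀ t : ℝ, IsClosed (({t} : Set ℝ) ×ˢ K.range) := fun t =>
    isClosed_singleton.prod K.isCompact_range.isClosed
  have hd₁ : Disjoint P ({t₁} ×ˢ K.range) := Set.disjoint_left.2 fun q h h' =>
    (hPt q h).ne h'.1
  have hd₂ : Disjoint R ({t₂} ×ˢ K.range) := Set.disjoint_left.2 fun q h h' =>
    (hRt q h).ne' h'.1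
  obtain ⟨G, hG, hEG, hFG, hc⟩ := K.exists_isCellDecomposition_collar ht hE
    (hE.isUnionOfCells_left (union_comm P _ ▸ hEB) (hK _) hP hd₁.symm) hF
    (hF.isUnionOfCells_left hFB (hK _) hR hd₂.symm) hA₁ hA₂
  exact ⟨G, hG, ((hE.isUnionOfCells_left hEB hP (hK _) hd₁).mono hEG).union
    ((hF.isUnionOfCells_left (union_comm R _ ▸ hFB) hR (hK _) hd₂).mono hFG), hc⟩

/-- The collar is closed off by a slice with one vertex and one edge per component, of total count
zero. -/
theorem HasEulerCharacteristic.extend_upper {A P : Set Space4} {K : OrientedLink} {t₁ t₂ : ℝ}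
    {χ : ℤ} (ht : t₁ < t₂) (h : HasEulerCharacteristic A (P ∪ {t₁} ×ˢ K.range) χ)
    (hP : IsClosed P) (hPt : ∀ q ∈ P, q.1 < t₁) (hA : ∀ q ∈ A, q.1 ≤ t₁) :
    HasEulerCharacteristic (A ∪ Ioc t₁ t₂ ×ˢ K.range) (P ∪ {t₂} ×ˢ K.range) χ := by
  rw [hasEulerCharacteristic_iff] at h ⊢
  obtain ⟨E, hE, hEB, rfl⟩ := h
  have hK : IsClosed (({t₁} : Set ℝ) ×ˢ K.range) :=
    isClosed_singleton.prod K.isCompact_range.isClosed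
  have hd : Disjoint P ({t₁} ×ˢ K.range) := Set.disjoint_left.2 fun q h h' =>
    (hPt q h).ne h'.1
  obtain ⟨G, hG, hEG, hFG, hc⟩ := K.exists_isCellDecomposition_collar ht hE
    (hE.isUnionOfCells_left (union_comm P _ ▸ hEB) hK hP hd.symm)
    (K.isCellDecomposition_sliceCells t₂) (K.isUnionOfCells_sliceCells t₂) hA (fun q hq => hq.1.ge)
  refine ⟨G, ?_, ((hE.isUnionOfCells_left hEB hP hK hd).mono hEG).union
    ((K.isUnionOfCells_sliceCells t₂).mono hFG), by rw [hc, K.cellCount_sliceCells, add_zero]⟩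
  rwa [union_assoc, ← union_prod, singleton_union, Ioo_insert_right ht] at hG

theorem HasEulerCharacteristic.extend_lower {A R : Set Space4} {K : OrientedLink} {t₁ t₂ : ℝ}
    {χ : ℤ} (ht : t₁ < t₂) (h : HasEulerCharacteristic A ({t₂} ×ˢ K.range ∪ R) χ)
    (hR : IsClosed R) (hRt : ∀ q ∈ R, t₂ < q.1) (hA : ∀ q ∈ A, t₂ ≤ q.1) :
    HasEulerCharacteristic (Ico t₁ t₂ ×ˢ K.range ∪ A) ({t₁} ×ˢ K.range ∪ R) χ := by
  rw [hasEulerCharacteristic_iff] at h ⊢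
  obtain ⟨F, hF, hFB, rfl⟩ := h
  have hK : IsClosed (({t₂} : Set ℝ) ×ˢ K.range) :=
    isClosed_singleton.prod K.isCompact_range.isClosed
  have hd : Disjoint R ({t₂} ×ˢ K.range) := Set.disjoint_left.2 fun q h h' =>
    (hRt q h).ne' h'.1
  obtain ⟨G, hG, hEG, hFG, hc⟩ := K.exists_isCellDecomposition_collar ht
    (K.isCellDecomposition_sliceCells t₁) (K.isUnionOfCells_sliceCells t₁) hF
    (hF.isUnionOfCells_left hFB hK hR hd.symm) (fun q hq => hq.1.le) hA
  refine ⟨G, ?_, ((K.isUnionOfCells_sliceCells t₁).mono hEG).union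
    ((hF.isUnionOfCells_left (union_comm R _ ▸ hFB) hR hK hd).mono hFG),
    by rw [hc, K.cellCount_sliceCells, zero_add]⟩
  rwa [union_right_comm, ← union_prod, singleton_union, Ioo_insert_left ht] at hG

theorem HasEulerCharacteristic.preimage {A B : Set Space4} {χ : ℤ}
    (hA : HasEulerCharacteristic A B χ) (h : Space4 ≃ₜ Space4) :
    HasEulerCharacteristic (h ⁻¹' A) (h ⁻¹' B) χ := by
  rw [hasEulerCharacteristic_iff] at hA ⊢
  obtain ⟨E, hE, hEB, rfl⟩ := hA
  obtain ⟨h1, h2⟩ := hE.image h.symm.continuous h.symm.injective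
  rw [← h.image_symm]
  exact ⟨_, h1, hEB.image _, h2⟩

/-! ### Smooth surfaces, tangent cones and area forms -/

theorem IsSmoothSurface.of_locally {S : Set Space4}
    (h : ∀ p ∈ S, ∃ S' U, IsSmoothSurface S' ∧ IsOpen U ∧ p ∈ U ∧ ∀ q ∈ U, q ∈ S ↔ q ∈ S') :
    IsSmoothSurface S := by
  intro p hp
  obtain ⟨S', U, hS', hU, hpU, hSU⟩ := h p hp
  obtain ⟨Φ, hpΦ, h1, h2, h3⟩ := hS' p ((hSU p hpU).1 hp)
  refine ⟨Φ.restrOpen U hU, ⟨hpΦ, hpU⟩, h1.mono inter_subset_left, h2.mono inter_subset_left, ?_⟩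
  intro q hq
  exact (hSU q hq.2).trans (h3 q hq.1)

theorem tangentConeAt_congr_of_isOpen {S S' U : Set Space4} (hU : IsOpen U) {p : Space4}
    (hp : p ∈ U) (h : ∀ q ∈ U, q ∈ S ↔ q ∈ S') : tangentConeAt ℝ S p = tangentConeAt ℝ S' p := by
  rw [← tangentConeAt_inter_nhds (hU.mem_nhds hp),
    ← tangentConeAt_inter_nhds (s := S') (hU.mem_nhds hp)]
  congr 1
  ext q
  exact and_congr_left (h q)

theorem mem_tangentConeAt_of_hasDerivAt {S : Set Space4} {γ : ℝ → Space4} {v : Space4} {s : ℝ}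
    (hγ : HasDerivAt γ v s) (hS : ∀ s, γ s ∈ S) : v ∈ tangentConeAt ℝ S (γ s) := by
  have h1 : (1 : ℝ) ∈ tangentConeAt ℝ univ s := by
    rw [tangentConeAt_univ]
    trivial
  have h := (hγ.hasFDerivAt.hasFDerivWithinAt (s := univ)).mapsTo_tangent_cone h1
  have h' := tangentConeAt_mono (𝕜 := ℝ) (x := γ s) (image_subset_iff.2 fun s _ => hS s) h
  simpa using h'

/-- The tangent cone of a smooth surface is contained in a plane. -/
theorem IsSmoothSurface.exists_tangentConeAt_subset {S : Set Space4} (hS : IsSmoothSurface S)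
    {p : Space4} (hp : p ∈ S) :
    ∃ V : Submodule ℝ Space4, Module.finrank ℝ V ≤ 2 ∧ tangentConeAt ℝ S p ⊆ V := by
  obtain ⟨Φ, hpΦ, h1, h2, h3⟩ := hS p hp
  have hΦ : HasFDerivAt Φ (fderiv ℝ Φ p) p :=
    ((h1.contDiffAt (Φ.open_source.mem_nhds hpΦ)).differentiableAt (by simp)).hasFDerivAt
  have hΨ : HasFDerivAt Φ.symm (fderiv ℝ Φ.symm (Φ p)) (Φ p) :=
    ((h2.contDiffAt (Φ.open_target.mem_nhds (Φ.map_source hpΦ))).differentiableAt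
      (by simp)).hasFDerivAt
  have hid : (fderiv ℝ Φ.symm (Φ p)).comp (fderiv ℝ Φ p) = ContinuousLinearMap.id ℝ Space4 := by
    refine (hΨ.comp p hΦ).unique ((hasFDerivAt_id p).congr_of_eventuallyEq ?_)
    filter_upwards [Φ.open_source.mem_nhds hpΦ] with q hq using Φ.left_inv hq
  have hinj : Function.Injective (fderiv ℝ Φ p) := fun u v huv => by
    have := congrArg (fderiv ℝ Φ.symm (Φ p)) huv
    rwa [← ContinuousLinearMap.comp_apply, ← ContinuousLinearMap.comp_apply, hid] at this
  set D := fderiv ℝ Φ p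
  set N := (ContinuousLinearMap.snd ℝ (ℝ × ℝ) (ℝ × ℝ)).comp D with hN
  refine ⟨N.toLinearMap.ker, ?_, ?_⟩
  · let T : N.toLinearMap.ker →ₗ[ℝ] ℝ × ℝ :=
      ((ContinuousLinearMap.fst ℝ (ℝ × ℝ) (ℝ × ℝ)).comp D).toLinearMap ∘ₗ N.toLinearMap.ker.subtype
    have hT : Function.Injective T := by
      intro u v huv
      refine Subtype.ext (hinj (Prod.ext huv ?_))
      exact (LinearMap.mem_ker.1 u.2).trans (LinearMap.mem_ker.1 v.2).symm
    simpa using LinearMap.finrank_le_finrank_of_injective hT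
  · intro u hu
    rw [← tangentConeAt_inter_nhds (Φ.open_source.mem_nhds hpΦ)] at hu
    have hg : HasFDerivWithinAt (fun q => (Φ q).2) N (S ∩ Φ.source) p :=
      (hasFDerivAt_snd.comp p hΦ).hasFDerivWithinAt
    have h0 := hg.mapsTo_tangent_cone hu
    have hsub : (fun q => (Φ q).2) '' (S ∩ Φ.source) ⊆ {0} := by
      rintro _ ⟨q, ⟨hq, hqΦ⟩, rfl⟩
      exact (h3 q hqΦ).1 hq
    have h0' := tangentConeAt_mono hsub h0
    -- In the chart the surface has second component zero, and a one-point set has no accumulation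
    -- point, so its tangent cone is trivial.
    have h0'' := tangentConeAt_subset_zero (𝕜 := ℝ) (x := (Φ p).2) (s := {(0 : ℝ × ℝ)}) (by
      rw [accPt_iff_frequently]
      intro hf
      refine hf ?_
      rw [show (Φ p).2 = 0 from (h3 p hpΦ).1 hp]
      exact Filter.Eventually.of_forall fun y hy => hy.1 hy.2) h0'
    exact h0''

/-- Area forms on a tangent plane are proportional. -/
theorem IsSmoothSurface.exists_ne_zero_smul {S : Set Space4} (hS : IsSmoothSurface S)
    {p : Space4} (hp : p ∈ S) {e₁ e₂ u v : Space4} (he₁ : e₁ ∈ tangentConeAt ℝ S p)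
    (he₂ : e₂ ∈ tangentConeAt ℝ S p) (hu : u ∈ tangentConeAt ℝ S p)
    (hv : v ∈ tangentConeAt ℝ S p) (he : LinearIndependent ℝ ![e₁, e₂])
    (huv : LinearIndependent ℝ ![u, v]) :
    ∃ d : ℝ, d ≠ 0 ∧ ∀ B : Space4 →L[ℝ] Space4 →L[ℝ] ℝ, (∀ w, B w w = 0) →
      B u v = d * B e₁ e₂ := by
  obtain ⟨V, hV, hSV⟩ := hS.exists_tangentConeAt_subset hp
  have hspan : Submodule.span ℝ {e₁, e₂} = V := by
    refine Submodule.eq_of_le_of_finrank_le ?_ ?_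
    · rw [Submodule.span_le]
      rintro _ (rfl | rfl)
      exacts [hSV he₁, hSV he₂]
    · have := finrank_span_eq_card he
      rw [Matrix.range_cons, Matrix.range_cons, Matrix.range_empty, union_empty,
        singleton_union] at this
      rw [this]
      simpa using hV
  have hu' := hSV hu
  have hv' := hSV hv
  rw [SetLike.mem_coe, ← hspan, Submodule.mem_span_pair] at hu' hv'
  obtain ⟨α, β, rfl⟩ := hu'
  obtain ⟨γ, δ, rfl⟩ := hv'
  -- The factor is the determinant of `(u, v)` in the basis `(e₁, e₂)`. If it vanished, Cramer's
  -- relations `δ u = β v` and `γ u = α v` would force all coefficients, hence `u`, to be zero.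
  refine ⟨α * δ - β * γ, ?_, ?_⟩
  · intro h0
    rw [LinearIndependent.pair_iff] at huv
    have h1 := huv δ (-β) (by
      have : δ • (α • e₁ + β • e₂) + -β • (γ • e₁ + δ • e₂) = (α * δ - β * γ) • e₁ := by module
      rw [this, h0, zero_smul])
    have h2 := huv γ (-α) (by
      have : γ • (α • e₁ + β • e₂) + -α • (γ • e₁ + δ • e₂) = -((α * δ - β * γ) • e₂) := by module
      rw [this, h0, zero_smul, neg_zero])
    have h3 := huv 1 0 (by
      rw [neg_eq_zero.1 h1.2, neg_eq_zero.1 h2.2]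
      simp)
    exact one_ne_zero h3.1
  · intro B hB
    have hanti : B e₂ e₁ = -B e₁ e₂ := by
      have := hB (e₁ + e₂)
      simp only [map_add, add_apply, hB] at this
      linarith
    simp only [map_add, map_smul, add_apply, smul_apply,
      hB, hanti, smul_eq_mul]
    ring

/-! ### Affine changes of `t` -/

/-- The affine change `t ↦ a t + b` of the first coordinate of `ℝ × ℝ³`. -/
noncomputable def rescale (a b : ℝ) (ha : a ≠ 0) : Space4 ≃ₜ Space4 where
  toFun q := (a * q.1 + b, q.2)
  invFun q := (a⁻¹ * (q.1 - b), q.2)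
  left_inv q := Prod.ext (by field_simp; ring) rfl
  right_inv q := Prod.ext (by field_simp; ring) rfl
  continuous_toFun := by fun_prop
  continuous_invFun := by fun_prop

theorem rescale_apply {a b : ℝ} (ha : a ≠ 0) (q : Space4) :
    rescale a b ha q = (a * q.1 + b, q.2) := rfl

/-- The linear part of `rescale`. -/
noncomputable def rescaleLinear (a : ℝ) : Space4 →L[ℝ] Space4 :=
  (a • ContinuousLinearMap.fst ℝ ℝ Space3).prod (ContinuousLinearMap.snd ℝ ℝ Space3)

theorem hasFDerivAt_rescale {a b : ℝ} (ha : a ≠ 0) (q : Space4) :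
    HasFDerivAt (rescale a b ha) (rescaleLinear a) q :=
  ((hasFDerivAt_fst.const_mul a).add_const b).prodMk hasFDerivAt_snd

theorem contDiff_rescale {a b : ℝ} (ha : a ≠ 0) : ContDiff ℝ ∞ (rescale a b ha) :=
  ((contDiff_const.mul contDiff_fst).add contDiff_const).prodMk contDiff_snd

theorem contDiff_rescale_symm {a b : ℝ} (ha : a ≠ 0) : ContDiff ℝ ∞ (rescale a b ha).symm :=
  (contDiff_const.mul (contDiff_fst.sub contDiff_const)).prodMk contDiff_snd

theorem IsSmoothSurface.preimage_rescale {S : Set Space4} (hS : IsSmoothSurface S) {a b : ℝ}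
    (ha : a ≠ 0) : IsSmoothSurface (rescale a b ha ⁻¹' S) := by
  intro p hp
  obtain ⟨Φ, hpΦ, h1, h2, h3⟩ := hS _ hp
  refine ⟨(rescale a b ha).transOpenPartialHomeomorph Φ, hpΦ, ?_, ?_, fun q hq => h3 _ hq⟩
  · exact h1.comp (contDiff_rescale ha).contDiffOn fun q hq => hq
  · exact (contDiff_rescale_symm ha).comp_contDiffOn h2

/-- The pullback alone would evaluate on a product basis with a factor `a`; the extra factor makes
it `a * a`, so the cylinders keep their product orientation even when `t` is reversed. -/
theorem IsOrientationForm.preimage_rescale {S : Set Space4}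
    {Ω : Space4 → Space4 →L[ℝ] Space4 →L[ℝ] ℝ} (hΩ : IsOrientationForm S Ω) {a b : ℝ}
    (ha : a ≠ 0) : IsOrientationForm (rescale a b ha ⁻¹' S) fun q =>
      a • (Ω (rescale a b ha q)).bilinearComp (rescaleLinear a) (rescaleLinear a) := by
  have htan : ∀ {p u}, u ∈ tangentConeAt ℝ (rescale a b ha ⁻¹' S) p →
      rescaleLinear a u ∈ tangentConeAt ℝ S (rescale a b ha p) := fun {p u} hu =>
    tangentConeAt_mono (image_preimage_subset _ _)
      ((hasFDerivAt_rescale ha p).hasFDerivWithinAt.mapsTo_tangent_cone hu)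
  refine ⟨?_, fun p hp u => ?_, fun p hp u hu v hv huv => ?_⟩
  · rw [continuousOn_clm_apply]
    intro u
    rw [continuousOn_clm_apply]
    intro v
    have h : ContinuousOn (fun q => Ω (rescale a b ha q)) (rescale a b ha ⁻¹' S) :=
      hΩ.continuousOn.comp (rescale a b ha).continuous.continuousOn (mapsTo_preimage _ _)
    exact ((h.clm_apply (continuousOn_const (c := rescaleLinear a u))).clm_apply
      (continuousOn_const (c := rescaleLinear a v))).const_smul a
  · exact (congrArg (a • ·) (hΩ.alternating _ hp _)).trans (smul_zero a)
  · refine mul_ne_zero ha (hΩ.nonvanishing _ hp _ (htan hu) _ (htan hv) ?_)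
    have hinj : Function.Injective (rescaleLinear a) := fun u v h => by
      obtain ⟨h1, h2⟩ := Prod.mk.inj h
      exact Prod.ext (mul_left_cancel₀ ha h1) h2
    have := huv.map' (rescaleLinear a).toLinearMap (LinearMap.ker_eq_bot.2 hinj)
    rwa [show (rescaleLinear a).toLinearMap ∘ ![u, v] = ![rescaleLinear a u, rescaleLinear a v] from
      funext fun i => by fin_cases i <;> rfl] at this

/-! ### Rescaled, reversed and stacked cobordisms -/

namespace Cobordism

variable {K₀ K₁ K₂ : OrientedLink}

theorem mem_iff_of_le (W : Cobordism K₀ K₁) {q : Space4} (hq : q.1 ≤ W.T₀) :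
    q ∈ W.carrier ↔ q.2 ∈ K₀.range := by
  have := Set.ext_iff.1 W.lower_end q
  simpa [hq] using this

theorem mem_iff_of_ge (W : Cobordism K₀ K₁) {q : Space4} (hq : W.T₁ ≤ q.1) :
    q ∈ W.carrier ↔ q.2 ∈ K₁.range := by
  have := Set.ext_iff.1 W.upper_end q
  simpa [hq] using this

/-- The image of a cobordism under an increasing affine change of `t`. -/
noncomputable def rescaled (W : Cobordism K₀ K₁) (a b : ℝ) (ha : 0 < a) : Cobordism K₀ K₁ where
  carrier := rescale a b ha.ne' ⁻¹' W.carrier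
  T₀ := (W.T₀ - b) / a
  T₁ := (W.T₁ - b) / a
  T₀_lt_T₁ := div_lt_div_of_pos_right (sub_lt_sub_right W.T₀_lt_T₁ b) ha
  isSmoothSurface := W.isSmoothSurface.preimage_rescale ha.ne'
  isCompact := by
    convert (rescale a b ha.ne').isCompact_preimage.2 W.isCompact using 1
    ext q
    simp only [mem_inter_iff, mem_preimage, mem_ofPred_eq, rescale_apply, div_le_iff₀ ha,
      le_div_iff₀ ha, mul_comm q.1, sub_le_iff_le_add, le_sub_iff_add_le]
  lower_end := by
    ext q
    have : q.1 ≤ (W.T₀ - b) / a ↔ (rescale a b ha.ne' q).1 ≤ W.T₀ := by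
      rw [le_div_iff₀ ha, le_sub_iff_add_le, mul_comm]; rfl
    simp only [mem_inter_iff, mem_ofPred_eq, mem_prod, mem_Iic, mem_preimage, this]
    rw [and_comm]
    exact and_congr_right fun h => W.mem_iff_of_le h
  upper_end := by
    ext q
    have : (W.T₁ - b) / a ≤ q.1 ↔ W.T₁ ≤ (rescale a b ha.ne' q).1 := by
      rw [div_le_iff₀ ha, sub_le_iff_le_add, mul_comm]; rfl
    simp only [mem_inter_iff, mem_ofPred_eq, mem_prod, mem_Ici, mem_preimage, this]
    rw [and_comm]
    exact and_congr_right fun h => W.mem_iff_of_ge h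
  orientable := by
    obtain ⟨Ω, hΩ, h0, h1⟩ := W.orientable
    have key : ∀ (p v : Space3) (t : ℝ), (a • (Ω (rescale a b ha.ne' (t, p))).bilinearComp
        (rescaleLinear a) (rescaleLinear a)) (1, 0) (0, v) =
        a * a * Ω (a * t + b, p) (1, 0) (0, v) := by
      intro p v t
      have e1 : rescaleLinear a ((1, 0) : Space4) = a • ((1, 0) : Space4) :=
        Prod.ext rfl (smul_zero a).symm
      have e2 : rescaleLinear a ((0, v) : Space4) = (0, v) := Prod.ext (mul_zero a) rfl
      simp only [smul_apply, ContinuousLinearMap.bilinearComp_apply, e1, e2, map_smul,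
        smul_eq_mul, rescale_apply]
      ring
    refine ⟨_, hΩ.preimage_rescale ha.ne', fun t ht i s => ?_, fun t ht i s => ?_⟩
    · rw [key]
      rw [le_div_iff₀ ha] at ht
      exact mul_pos (mul_pos ha ha) (h0 _ (by linarith) i s)
    · rw [key]
      rw [div_le_iff₀ ha] at ht
      exact mul_pos (mul_pos ha ha) (h1 _ (by linarith) i s)

/-- The cobordism `W` with the direction of `t` reversed. -/
noncomputable def reversed (W : Cobordism K₀ K₁) : Cobordism K₁ K₀ where
  carrier := rescale (-1) 0 (by norm_num) ⁻¹' W.carrier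
  T₀ := -W.T₁
  T₁ := -W.T₀
  T₀_lt_T₁ := neg_lt_neg W.T₀_lt_T₁
  isSmoothSurface := W.isSmoothSurface.preimage_rescale _
  isCompact := by
    convert (rescale (-1) 0 (by norm_num)).isCompact_preimage.2 W.isCompact using 1
    ext q
    simp only [mem_inter_iff, mem_preimage, mem_ofPred_eq, rescale_apply]
    refine and_congr_right fun _ => ?_
    constructor <;> rintro ⟨h1, h2⟩ <;> constructor <;> linarith
  lower_end := by
    ext q
    have : q.1 ≤ -W.T₁ ↔ W.T₁ ≤ (rescale (-1) 0 (by norm_num) q).1 := by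
      rw [rescale_apply]
      constructor <;> intro h <;> linarith
    simp only [mem_inter_iff, mem_ofPred_eq, mem_prod, mem_Iic, mem_preimage, this]
    rw [and_comm]
    exact and_congr_right fun h => W.mem_iff_of_ge h
  upper_end := by
    ext q
    have : -W.T₀ ≤ q.1 ↔ (rescale (-1) 0 (by norm_num) q).1 ≤ W.T₀ := by
      rw [rescale_apply]
      constructor <;> intro h <;> linarith
    simp only [mem_inter_iff, mem_ofPred_eq, mem_prod, mem_Ici, mem_preimage, this]
    rw [and_comm]
    exact and_congr_right fun h => W.mem_iff_of_le h
  orientable := by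
    obtain ⟨Ω, hΩ, h0, h1⟩ := W.orientable
    have h : (-1 : ℝ) ≠ 0 := by norm_num
    have key : ∀ (p v : Space3) (t : ℝ), ((-1 : ℝ) • (Ω (rescale (-1) 0 h (t, p))).bilinearComp
        (rescaleLinear (-1)) (rescaleLinear (-1))) (1, 0) (0, v) =
        Ω (-t, p) (1, 0) (0, v) := by
      intro p v t
      have e1 : rescaleLinear (-1) ((1, 0) : Space4) = (-1 : ℝ) • ((1, 0) : Space4) :=
        Prod.ext rfl (smul_zero _).symm
      have e2 : rescaleLinear (-1) ((0, v) : Space4) = (0, v) := Prod.ext (mul_zero _) rfl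
      simp only [smul_apply, ContinuousLinearMap.bilinearComp_apply, e1, e2, map_smul,
        smul_eq_mul, rescale_apply]
      rw [neg_one_mul, neg_one_mul, neg_neg, neg_one_mul, add_zero]
    refine ⟨_, hΩ.preimage_rescale h, fun t ht i s => ?_, fun t ht i s => ?_⟩
    · rw [key]
      exact h1 _ (le_neg.1 ht) i s
    · rw [key]
      exact h0 _ (neg_le.1 ht) i s

theorem HasEulerChar.rescaled {W : Cobordism K₀ K₁} {χ : ℤ} (h : W.HasEulerChar χ) {a b : ℝ}
    (ha : 0 < a) : (W.rescaled a b ha).HasEulerChar χ := by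
  have h' := HasEulerCharacteristic.preimage h (rescale a b ha.ne')
  have hc : (W.rescaled a b ha).compactPart = rescale a b ha.ne' ⁻¹' W.compactPart := by
    ext q
    simp only [compactPart, Cobordism.rescaled, mem_inter_iff, mem_preimage, mem_ofPred_eq,
      rescale_apply, div_le_iff₀ ha,
      le_div_iff₀ ha, mul_comm q.1, sub_le_iff_le_add, le_sub_iff_add_le]
  have hb : (W.rescaled a b ha).boundary = rescale a b ha.ne' ⁻¹' W.boundary := by
    ext q
    simp only [boundary, Cobordism.rescaled, mem_union, mem_prod, mem_singleton_iff, mem_preimage,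
      rescale_apply, eq_div_iff ha.ne', mul_comm q.1, eq_sub_iff_add_eq]
  rw [Cobordism.HasEulerChar, hc, hb]
  exact h'

theorem HasEulerChar.reversed {W : Cobordism K₀ K₁} {χ : ℤ} (h : W.HasEulerChar χ) :
    W.reversed.HasEulerChar χ := by
  have hne : (-1 : ℝ) ≠ 0 := by norm_num
  have h' := HasEulerCharacteristic.preimage h (rescale (-1) 0 hne)
  have hc : W.reversed.compactPart = rescale (-1) 0 hne ⁻¹' W.compactPart := by
    ext q
    simp only [compactPart, Cobordism.reversed, mem_inter_iff, mem_preimage, mem_ofPred_eq,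
      rescale_apply]
    refine and_congr_right fun _ => ?_
    constructor <;> rintro ⟨h1, h2⟩ <;> constructor <;> linarith
  have hb : W.reversed.boundary = rescale (-1) 0 hne ⁻¹' W.boundary := by
    ext q
    have e : ∀ x : ℝ, q.1 = -x ↔ -1 * q.1 + 0 = x := fun x => by
      constructor <;> intro h <;> linarith
    simp only [boundary, Cobordism.reversed, mem_union, mem_prod, mem_singleton_iff, mem_preimage,
      rescale_apply, e]
    exact or_comm
  rw [Cobordism.HasEulerChar, hc, hb]
  exact h'

theorem exists_stacked (W : Cobordism K₀ K₁) (k : ℕ) :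
    ∃ W' : Cobordism K₀ K₁, (k : ℝ) < W'.T₀ ∧ W'.T₁ < k + 1 ∧
      (∀ q : Space4, (k : ℝ) ≤ q.1 → q.1 ≤ k + 1 → (q ∈ W'.carrier ↔ q ∈ W.stacked k)) ∧
      ∀ χ, W.HasEulerChar χ → W'.HasEulerChar χ := by
  have ha : 0 < W.T₁ - W.T₀ + 2 := by linarith [W.T₀_lt_T₁]
  -- This map sends `[k, k + 1]` onto `[T₀ - 1, T₁ + 1]`; the unit collars make the new ends lie
  -- strictly inside the slab.
  refine ⟨W.rescaled (W.T₁ - W.T₀ + 2) (W.T₀ - 1 - k * (W.T₁ - W.T₀ + 2)) ha, ?_, ?_, ?_,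
    fun χ h => h.rescaled ha⟩
  · change (k : ℝ) < (_ - _) / _
    rw [lt_div_iff₀ ha]
    linarith
  · change (_ - _) / _ < (k : ℝ) + 1
    rw [div_lt_iff₀ ha]
    linarith
  · intro q h1 h2
    have : (W.T₁ - W.T₀ + 2) * q.1 + (W.T₀ - 1 - k * (W.T₁ - W.T₀ + 2)) =
      W.T₀ - 1 + (q.1 - k) * (W.T₁ - W.T₀ + 2) := by ring
    simp only [Cobordism.rescaled, mem_preimage, rescale_apply, this, stacked, mem_ofPred_eq, h1,
      h2, true_and]

theorem stacked_reversed (W : Cobordism K₀ K₁) (k : ℕ) :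
    W.reversed.stacked k = W.stackedReversed k := by
  ext q
  have : -1 * (-W.T₁ - 1 + (q.1 - k) * (-W.T₀ - -W.T₁ + 2)) + 0 =
    W.T₁ + 1 - (q.1 - k) * (W.T₁ - W.T₀ + 2) := by ring
  simp only [stacked, stackedReversed, Cobordism.reversed, mem_ofPred_eq, mem_preimage,
    rescale_apply, this]

theorem exists_stackedReversed (W : Cobordism K₀ K₁) (k : ℕ) :
    ∃ W' : Cobordism K₁ K₀, (k : ℝ) < W'.T₀ ∧ W'.T₁ < k + 1 ∧
      (∀ q : Space4, (k : ℝ) ≤ q.1 → q.1 ≤ k + 1 → (q ∈ W'.carrier ↔ q ∈ W.stackedReversed k)) ∧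
      ∀ χ, W.HasEulerChar χ → W'.HasEulerChar χ := by
  obtain ⟨W', h0, h1, h2, h3⟩ := W.reversed.exists_stacked k
  exact ⟨W', h0, h1, fun q hq hq' => by rw [h2 q hq hq', stacked_reversed],
    fun χ h => h3 χ h.reversed⟩

end Cobordism

/-! ### Gluing cobordisms along a cylinder -/

theorem OrientedLink.exists_tangent_basis (K : OrientedLink) {q : Space4} (hq : q.2 ∈ K.range) :
    ∃ i s, q.2 = K.curve i s ∧
      LinearIndependent ℝ ![((1, 0) : Space4), (0, deriv (K.curve i) s)] ∧
      ((1, 0) : Space4) ∈ tangentConeAt ℝ (univ ×ˢ K.range) q ∧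
      ((0, deriv (K.curve i) s) : Space4) ∈ tangentConeAt ℝ (univ ×ˢ K.range) q := by
  obtain ⟨t, p⟩ := q
  obtain ⟨i, s, rfl⟩ := mem_iUnion.1 hq
  refine ⟨i, s, rfl, ?_, ?_, ?_⟩
  · rw [LinearIndependent.pair_iff]
    intro x y h
    obtain ⟨h1, h2⟩ := Prod.mk.inj h
    constructor
    · simpa using h1
    · simpa [K.regular i s] using h2
  · have hγ : HasDerivAt (fun τ : ℝ => ((τ, K.curve i s) : Space4)) (1, 0) t :=
      (hasDerivAt_id t).prodMk (hasDerivAt_const t _)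
    exact mem_tangentConeAt_of_hasDerivAt hγ fun τ => ⟨trivial, K.curve_mem_range i s⟩
  · have hγ : HasDerivAt (fun σ : ℝ => ((t, K.curve i σ) : Space4)) (0, deriv (K.curve i) s) s :=
      (hasDerivAt_const s t).prodMk
        (((K.smooth i).differentiable (by simp)).differentiableAt.hasDerivAt)
    exact mem_tangentConeAt_of_hasDerivAt hγ fun σ => ⟨trivial, K.curve_mem_range i σ⟩

theorem exists_cutoff {c d : ℝ} (hcd : c < d) :
    ∃ φ : ℝ → ℝ, Continuous φ ∧ (∀ t, 0 ≤ φ t ∧ φ t ≤ 1) ∧ (∀ t ≤ c, φ t = 0) ∧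
      ∀ t, d ≤ t → φ t = 1 := by
  refine ⟨fun t => max 0 (min 1 ((t - c) / (d - c))), by fun_prop,
    fun t => ⟨le_max_left _ _, max_le zero_le_one (min_le_left _ _)⟩, fun t ht => ?_, fun t ht => ?_⟩
  · exact max_eq_left ((min_le_right _ _).trans
      (div_nonpos_of_nonpos_of_nonneg (sub_nonpos.2 ht) (sub_pos.2 hcd).le))
  · have : 1 ≤ (t - c) / (d - c) := (one_le_div (sub_pos.2 hcd)).2 (by linarith)
    simp only [min_eq_left this]
    exact max_eq_right zero_le_one

namespace Cobordism

variable {K₀ K₁ K₂ : OrientedLink}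

/-- The union of the lower part of `W₁` and the upper part of `W₂`, which overlap in the cylinder
`[W₁.T₁, W₂.T₀] × K₁`. -/
def gluedCarrier (W₁ : Cobordism K₀ K₁) (W₂ : Cobordism K₁ K₂) : Set Space4 :=
  {q | (q.1 ≤ W₂.T₀ ∧ q ∈ W₁.carrier) ∨ (W₁.T₁ ≤ q.1 ∧ q ∈ W₂.carrier)}

section

variable {W₁ : Cobordism K₀ K₁} {W₂ : Cobordism K₁ K₂}

theorem mem_gluedCarrier_left {q : Space4} (hq : q.1 ≤ W₂.T₀) :
    q ∈ gluedCarrier W₁ W₂ ↔ q ∈ W₁.carrier := by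
  constructor
  · rintro (h | h)
    · exact h.2
    · rw [W₁.mem_iff_of_ge h.1, ← W₂.mem_iff_of_le hq]
      exact h.2
  · exact fun h => Or.inl ⟨hq, h⟩

theorem mem_gluedCarrier_right {q : Space4} (hq : W₁.T₁ ≤ q.1) :
    q ∈ gluedCarrier W₁ W₂ ↔ q ∈ W₂.carrier := by
  constructor
  · rintro (h | h)
    · rw [W₂.mem_iff_of_le h.1, ← W₁.mem_iff_of_ge hq]
      exact h.2
    · exact h.2
  · exact fun h => Or.inr ⟨hq, h⟩

theorem isSmoothSurface_gluedCarrier (h : W₁.T₁ < W₂.T₀) :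
    IsSmoothSurface (gluedCarrier W₁ W₂) := by
  refine .of_locally fun p _ => ?_
  by_cases hp : p.1 < W₂.T₀
  · exact ⟨_, {q | q.1 < W₂.T₀}, W₁.isSmoothSurface, isOpen_lt continuous_fst continuous_const, hp,
      fun q hq => mem_gluedCarrier_left (le_of_lt hq)⟩
  · exact ⟨_, {q | W₁.T₁ < q.1}, W₂.isSmoothSurface, isOpen_lt continuous_const continuous_fst,
      h.trans_le (not_lt.1 hp), fun q hq => mem_gluedCarrier_right (le_of_lt hq)⟩

theorem gluedCarrier_inter (h : W₁.T₁ < W₂.T₀) :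
    gluedCarrier W₁ W₂ ∩ {q | W₁.T₀ ≤ q.1 ∧ q.1 ≤ W₂.T₁} =
      W₁.compactPart ∪ W₂.compactPart ∪ Ioo W₁.T₁ W₂.T₀ ×ˢ K₁.range := by
  have h1 := W₁.T₀_lt_T₁
  have h2 := W₂.T₀_lt_T₁
  ext q
  simp only [mem_inter_iff, mem_union, mem_ofPred_eq, compactPart, mem_prod, mem_Ioo]
  rcases le_or_gt q.1 W₁.T₁ with hq | hq
  · rw [mem_gluedCarrier_left (by linarith)]
    constructor
    · exact fun ⟨ha, hb⟩ => Or.inl (Or.inl ⟨ha, hb.1, hq⟩)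
    · rintro ((⟨ha, hb⟩ | ⟨ha, hb⟩) | ⟨hb, ha⟩)
      · exact ⟨ha, hb.1, by linarith⟩
      · linarith [hb.1]
      · linarith [hb.1]
  rw [mem_gluedCarrier_right hq.le]
  rcases le_or_gt W₂.T₀ q.1 with hq' | hq'
  · constructor
    · exact fun ⟨ha, hb⟩ => Or.inl (Or.inr ⟨ha, hq', hb.2⟩)
    · rintro ((⟨ha, hb⟩ | ⟨ha, hb⟩) | ⟨hb, ha⟩)
      · linarith [hb.2]
      · exact ⟨ha, by linarith, hb.2⟩
      · linarith [hb.2]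
  · rw [W₂.mem_iff_of_le hq'.le]
    constructor
    · exact fun ⟨ha, hb⟩ => Or.inr ⟨⟨hq, hq'⟩, ha⟩
    · rintro ((⟨ha, hb⟩ | ⟨ha, hb⟩) | ⟨hb, ha⟩)
      · linarith [hb.2]
      · linarith [hb.1]
      · exact ⟨ha, by linarith, by linarith⟩

/-- The open collar is replaced by the closed one, which overlaps the two compact parts in their
boundary circles. -/
theorem isCompact_gluedCarrier_inter (h : W₁.T₁ < W₂.T₀) :
    IsCompact (gluedCarrier W₁ W₂ ∩ {q | W₁.T₀ ≤ q.1 ∧ q.1 ≤ W₂.T₁}) := by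
  have : gluedCarrier W₁ W₂ ∩ {q | W₁.T₀ ≤ q.1 ∧ q.1 ≤ W₂.T₁} =
      W₁.compactPart ∪ W₂.compactPart ∪ Icc W₁.T₁ W₂.T₀ ×ˢ K₁.range := by
    refine subset_antisymm ?_ (union_subset ?_ ?_)
    · rw [gluedCarrier_inter h]
      exact union_subset_union_right _ (prod_mono_left Ioo_subset_Icc_self)
    · rw [gluedCarrier_inter h]
      exact subset_union_left
    · rintro q ⟨hq, hqK⟩
      refine ⟨(mem_gluedCarrier_left hq.2).2 ((W₁.mem_iff_of_ge hq.1).2 hqK), ?_, ?_⟩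
      · exact W₁.T₀_lt_T₁.le.trans hq.1
      · exact hq.2.trans W₂.T₀_lt_T₁.le
  rw [this]
  exact (W₁.isCompact.union W₂.isCompact).union (isCompact_Icc.prod K₁.isCompact_range)

theorem orientable_gluedCarrier (h : W₁.T₁ < W₂.T₀) :
    ∃ Ω, IsOrientationForm (gluedCarrier W₁ W₂) Ω ∧
      (∀ t ≤ W₁.T₀, ∀ i s, 0 < Ω (t, K₀.curve i s) (1, 0) (0, deriv (K₀.curve i) s)) ∧
      (∀ t, W₂.T₁ ≤ t → ∀ i s, 0 < Ω (t, K₂.curve i s) (1, 0) (0, deriv (K₂.curve i) s)) := by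
  obtain ⟨Ω₁, hΩ₁, hl₁, hu₁⟩ := W₁.orientable
  obtain ⟨Ω₂, hΩ₂, hl₂, hu₂⟩ := W₂.orientable
  -- The transition from `Ω₁` to `Ω₂` takes place over `[c, d]`, strictly inside the overlap, so
  -- that near every point the forms in use are defined along the surface.
  obtain ⟨c, hc, hcT⟩ := exists_between h
  obtain ⟨d, hcd, hd⟩ := exists_between hcT
  obtain ⟨φ, hφ, hφ01, hφ0, hφ1⟩ := exists_cutoff hcd
  have h1 := W₁.T₀_lt_T₁
  have h2 := W₂.T₀_lt_T₁
  let Ω : Space4 → Space4 →L[ℝ] Space4 →L[ℝ] ℝ :=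
    fun q => (1 - φ q.1) • Ω₁ q + φ q.1 • Ω₂ q
  have hΩv : ∀ q u v, Ω q u v = (1 - φ q.1) * Ω₁ q u v + φ q.1 * Ω₂ q u v := fun q u v => rfl
  have hΩ0 : ∀ q : Space4, q.1 ≤ c → Ω q = Ω₁ q := fun q hq =>
    ContinuousLinearMap.ext fun u => ContinuousLinearMap.ext fun v => by
      rw [hΩv, hφ0 _ hq]
      ring
  have hΩ1 : ∀ q : Space4, d ≤ q.1 → Ω q = Ω₂ q := fun q hq =>
    ContinuousLinearMap.ext fun u => ContinuousLinearMap.ext fun v => by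
      rw [hΩv, hφ1 _ hq]
      ring
  have left : ∀ {q : Space4}, q.1 < W₂.T₀ → (q ∈ gluedCarrier W₁ W₂ ↔ q ∈ W₁.carrier) :=
    fun hq => mem_gluedCarrier_left hq.le
  have right : ∀ {q : Space4}, W₁.T₁ < q.1 → (q ∈ gluedCarrier W₁ W₂ ↔ q ∈ W₂.carrier) :=
    fun hq => mem_gluedCarrier_right hq.le
  have hlt : ∀ x : ℝ, IsOpen {q : Space4 | q.1 < x} := fun x =>
    isOpen_lt continuous_fst continuous_const
  have hgt : ∀ x : ℝ, IsOpen {q : Space4 | x < q.1} := fun x =>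
    isOpen_lt continuous_const continuous_fst
  refine ⟨Ω, ⟨?_, ?_, ?_⟩, ?_, ?_⟩
  · refine continuousOn_of_locally_continuousOn fun p hp => ?_
    rcases lt_or_ge p.1 c with hpc | hpc
    · refine ⟨_, hlt c, hpc, ?_⟩
      refine (hΩ₁.continuousOn.mono ?_).congr fun q hq => hΩ0 q (le_of_lt hq.2)
      exact fun q hq => (left ((show q.1 < c from hq.2).trans hcT)).1 hq.1
    rcases lt_or_ge d p.1 with hpd | hpd
    · refine ⟨_, hgt d, hpd, ?_⟩
      refine (hΩ₂.continuousOn.mono ?_).congr fun q hq => hΩ1 q (le_of_lt hq.2)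
      exact fun q hq => (right ((hc.trans hcd).trans (show d < q.1 from hq.2))).1 hq.1
    · refine ⟨_, (hgt W₁.T₁).inter (hlt W₂.T₀), ⟨hc.trans_le hpc, hpd.trans_lt hd⟩, ?_⟩
      have hφ' : Continuous fun q : Space4 => φ q.1 := hφ.comp continuous_fst
      rw [continuousOn_clm_apply]
      intro u
      rw [continuousOn_clm_apply]
      intro v
      have val : ∀ {B : Space4 → Space4 →L[ℝ] Space4 →L[ℝ] ℝ} {T : Set Space4},
          ContinuousOn B T → ContinuousOn (fun q => B q u v) T := fun hB =>
        (hB.clm_apply (continuousOn_const (c := u))).clm_apply (continuousOn_const (c := v))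
      exact ((continuous_const.sub hφ').continuousOn.mul (val (hΩ₁.continuousOn.mono
        fun q hq => (left hq.2.2).1 hq.1))).add (hφ'.continuousOn.mul (val (hΩ₂.continuousOn.mono
        fun q hq => (right hq.2.1).1 hq.1)))
  · intro p hp u
    rcases le_or_gt p.1 c with hpc | hpc
    · rw [hΩ0 p hpc]
      exact hΩ₁.alternating p ((left (hpc.trans_lt hcT)).1 hp) u
    rcases le_or_gt d p.1 with hpd | hpd
    · rw [hΩ1 p hpd]
      exact hΩ₂.alternating p ((right ((hc.trans hcd).trans_le hpd)).1 hp) u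
    · rw [hΩv, hΩ₁.alternating p ((left (hpd.trans hd)).1 hp) u,
        hΩ₂.alternating p ((right (hc.trans hpc)).1 hp) u, mul_zero, mul_zero, add_zero]
  · intro p hp u hu v hv huv
    rcases le_or_gt p.1 c with hpc | hpc
    · rw [hΩ0 p hpc]
      have hpT := hpc.trans_lt hcT
      rw [tangentConeAt_congr_of_isOpen (hlt _) hpT fun q hq => left hq] at hu hv
      exact hΩ₁.nonvanishing p ((left hpT).1 hp) u hu v hv huv
    rcases le_or_gt d p.1 with hpd | hpd
    · rw [hΩ1 p hpd]
      have hpT := (hc.trans hcd).trans_le hpd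
      rw [tangentConeAt_congr_of_isOpen (hgt _) hpT fun q hq => right hq] at hu hv
      exact hΩ₂.nonvanishing p ((right hpT).1 hp) u hu v hv huv
    -- Here the surface is the cylinder over `K₁`. Both forms are positive on its product basis, and
    -- both are multiplied by the same nonzero factor on passing to `(u, v)`.
    · have hp₁ := (left (hpd.trans hd)).1 hp
      have hp₂ := (right (hc.trans hpc)).1 hp
      have hcyl : tangentConeAt ℝ (gluedCarrier W₁ W₂) p =
          tangentConeAt ℝ (univ ×ˢ K₁.range) p := by
        refine tangentConeAt_congr_of_isOpen ((hgt W₁.T₁).inter (hlt W₂.T₀))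
          ⟨hc.trans hpc, hpd.trans hd⟩ fun q hq => ?_
        rw [left hq.2, W₁.mem_iff_of_ge (le_of_lt hq.1), mem_prod]
        exact (and_iff_right trivial).symm
      obtain ⟨i, s, hps, hli, he₁, he₂⟩ :=
        K₁.exists_tangent_basis ((W₁.mem_iff_of_ge (hc.trans hpc).le).1 hp₁)
      rw [← hcyl] at he₁ he₂
      obtain ⟨k, hk, hB⟩ := (isSmoothSurface_gluedCarrier h).exists_ne_zero_smul hp he₁ he₂ hu hv
        hli huv
      have hp' : p = (p.1, K₁.curve i s) := Prod.ext rfl hps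
      have pos₁ := hu₁ p.1 (hc.trans hpc).le i s
      have pos₂ := hl₂ p.1 (hpd.trans hd).le i s
      rw [← hp'] at pos₁ pos₂
      rw [hΩv, hB (Ω₁ p) (hΩ₁.alternating p hp₁), hB (Ω₂ p) (hΩ₂.alternating p hp₂),
        mul_left_comm, mul_left_comm (φ p.1), ← mul_add]
      refine mul_ne_zero hk (ne_of_gt ?_)
      obtain ⟨hφ0, hφ1⟩ := hφ01 p.1
      rcases hφ1.eq_or_lt with e | hφ1
      · rw [e]
        linarith
      · exact add_pos_of_pos_of_nonneg (mul_pos (sub_pos.2 hφ1) pos₁) (mul_nonneg hφ0 pos₂.le)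
  · intro t ht i s
    rw [hΩ0 _ (by change t ≤ c; linarith)]
    exact hl₁ t ht i s
  · intro t ht i s
    rw [hΩ1 _ (by change d ≤ t; linarith)]
    exact hu₂ t ht i s

/-- The composition of two cobordisms along a cylinder. -/
def glue (W₁ : Cobordism K₀ K₁) (W₂ : Cobordism K₁ K₂) (h : W₁.T₁ < W₂.T₀) : Cobordism K₀ K₂ where
  carrier := gluedCarrier W₁ W₂
  T₀ := W₁.T₀
  T₁ := W₂.T₁
  T₀_lt_T₁ := (W₁.T₀_lt_T₁.trans h).trans W₂.T₀_lt_T₁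
  isSmoothSurface := isSmoothSurface_gluedCarrier h
  isCompact := isCompact_gluedCarrier_inter h
  lower_end := by
    rw [← W₁.lower_end]
    ext q
    exact and_congr_left fun hq : q.1 ≤ W₁.T₀ =>
      mem_gluedCarrier_left ((hq.trans W₁.T₀_lt_T₁.le).trans h.le)
  upper_end := by
    rw [← W₂.upper_end]
    ext q
    exact and_congr_left fun hq : W₂.T₁ ≤ q.1 =>
      mem_gluedCarrier_right ((h.le.trans W₂.T₀_lt_T₁.le).trans hq)
  orientable := orientable_gluedCarrier h

theorem HasEulerChar.glue {χ₁ χ₂ : ℤ} (h₁ : W₁.HasEulerChar χ₁) (h₂ : W₂.HasEulerChar χ₂)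
    (h : W₁.T₁ < W₂.T₀) : (W₁.glue W₂ h).HasEulerChar (χ₁ + χ₂) := by
  have := HasEulerCharacteristic.glue h h₁ h₂
    (isClosed_singleton.prod K₀.isCompact_range.isClosed)
    (isClosed_singleton.prod K₂.isCompact_range.isClosed)
    (fun q hq => (show q.1 = W₁.T₀ from hq.1).trans_lt W₁.T₀_lt_T₁)
    (fun q hq => W₂.T₀_lt_T₁.trans_eq (show q.1 = W₂.T₁ from hq.1).symm)
    (fun q hq => hq.2.2) (fun q hq => hq.2.1)
  rw [← gluedCarrier_inter h] at this
  exact this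

end

/-- A cobordism with longer cylindrical collars in its compact part. -/
def collared (W : Cobordism K₀ K₁) (t₀ t₁ : ℝ) (h₀ : t₀ < W.T₀) (h₁ : W.T₁ < t₁) :
    Cobordism K₀ K₁ where
  carrier := W.carrier
  T₀ := t₀
  T₁ := t₁
  T₀_lt_T₁ := (h₀.trans W.T₀_lt_T₁).trans h₁
  isSmoothSurface := W.isSmoothSurface
  isCompact := by
    have : W.carrier ∩ {q | t₀ ≤ q.1 ∧ q.1 ≤ t₁} =
        Icc t₀ W.T₀ ×ˢ K₀.range ∪ W.compactPart ∪ Icc W.T₁ t₁ ×ˢ K₁.range := by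
      ext q
      simp only [mem_inter_iff, mem_union, mem_ofPred_eq, compactPart, mem_prod, mem_Icc]
      have h := W.T₀_lt_T₁
      constructor
      · rintro ⟨ha, hb, hc⟩
        rcases le_or_gt q.1 W.T₀ with h0 | h0
        · exact Or.inl (Or.inl ⟨⟨hb, h0⟩, (W.mem_iff_of_le h0).1 ha⟩)
        rcases le_or_gt W.T₁ q.1 with h1 | h1
        · exact Or.inr ⟨⟨h1, hc⟩, (W.mem_iff_of_ge h1).1 ha⟩
        · exact Or.inl (Or.inr ⟨ha, h0.le, h1.le⟩)
      · rintro ((⟨hb, ha⟩ | ⟨ha, hb⟩) | ⟨hb, ha⟩)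
        · exact ⟨(W.mem_iff_of_le hb.2).2 ha, hb.1, by linarith [hb.2]⟩
        · exact ⟨ha, by linarith [hb.1], by linarith [hb.2]⟩
        · exact ⟨(W.mem_iff_of_ge hb.1).2 ha, by linarith [hb.1], hb.2⟩
    rw [this]
    exact ((isCompact_Icc.prod K₀.isCompact_range).union W.isCompact).union
      (isCompact_Icc.prod K₁.isCompact_range)
  lower_end := by
    ext q
    rw [mem_inter_iff, and_comm]
    exact and_congr_right fun hq : q.1 ≤ t₀ => W.mem_iff_of_le (hq.trans h₀.le)
  upper_end := by
    ext q
    rw [mem_inter_iff, and_comm]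
    exact and_congr_right fun hq : t₁ ≤ q.1 => W.mem_iff_of_ge (h₁.le.trans hq)
  orientable := by
    obtain ⟨Ω, hΩ, hl, hu⟩ := W.orientable
    exact ⟨Ω, hΩ, fun t ht => hl t (ht.trans h₀.le), fun t ht => hu t (h₁.le.trans ht)⟩

theorem HasEulerChar.collared {W : Cobordism K₀ K₁} {χ : ℤ} (h : W.HasEulerChar χ) {t₀ t₁ : ℝ}
    (h₀ : t₀ < W.T₀) (h₁ : W.T₁ < t₁) : (W.collared t₀ t₁ h₀ h₁).HasEulerChar χ := by
  have hT := W.T₀_lt_T₁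
  have hu := HasEulerCharacteristic.extend_upper h₁ h
    (isClosed_singleton.prod K₀.isCompact_range.isClosed)
    (fun q hq => (show q.1 = W.T₀ from hq.1).trans_lt W.T₀_lt_T₁) (fun q hq => hq.2.2)
  have hl := HasEulerCharacteristic.extend_lower h₀ hu
    (isClosed_singleton.prod K₁.isCompact_range.isClosed)
    (fun q hq => (hT.trans h₁).trans_eq (show q.1 = t₁ from hq.1).symm)
    (by
      rintro q (hq | hq)
      · exact hq.2.1
      · exact hT.le.trans hq.1.1.le)
  have : (W.collared t₀ t₁ h₀ h₁).compactPart =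
      Ico t₀ W.T₀ ×ˢ K₀.range ∪ (W.compactPart ∪ Ioc W.T₁ t₁ ×ˢ K₁.range) := by
    ext q
    simp only [mem_inter_iff, mem_union, mem_ofPred_eq, compactPart, mem_prod, mem_Ico, mem_Ioc,
      Cobordism.collared]
    constructor
    · rintro ⟨ha, hb, hc⟩
      rcases lt_or_ge q.1 W.T₀ with h0 | h0
      · exact Or.inl ⟨⟨hb, h0⟩, (W.mem_iff_of_le h0.le).1 ha⟩
      rcases lt_or_ge W.T₁ q.1 with h1 | h1
      · exact Or.inr (Or.inr ⟨⟨h1, hc⟩, (W.mem_iff_of_ge h1.le).1 ha⟩)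
      · exact Or.inr (Or.inl ⟨ha, h0, h1⟩)
    · rintro (⟨hb, ha⟩ | ⟨ha, hb⟩ | ⟨hb, ha⟩)
      · exact ⟨(W.mem_iff_of_le hb.2.le).2 ha, hb.1, by linarith [hb.2]⟩
      · exact ⟨ha, by linarith [hb.1], by linarith [hb.2]⟩
      · exact ⟨(W.mem_iff_of_ge hb.1.le).2 ha, by linarith [hb.1], hb.2⟩
  rw [Cobordism.HasEulerChar, this]
  exact hl

end Cobordism

/-! ### The smooth cobordism of a quasi-cobordism -/

theorem Cobordism.exists_glue_slab {K₀ K₁ K₂ : OrientedLink} {W₁ : Cobordism K₀ K₁}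
    {W₂ : Cobordism K₁ K₂} {a b c : ℝ} {S₁ S₂ : Set Space4} (ha : a < W₁.T₀) (hb₁ : W₁.T₁ < b)
    (hb₂ : b < W₂.T₀) (hc : W₂.T₁ < c)
    (hS₁ : W₁.carrier ∩ {q | a ≤ q.1 ∧ q.1 ≤ b} = S₁)
    (hS₂ : W₂.carrier ∩ {q | b ≤ q.1 ∧ q.1 ≤ c} = S₂) :
    ∃ W : Cobordism K₀ K₂, a < W.T₀ ∧ W.T₁ < c ∧
      W.carrier ∩ {q | a ≤ q.1 ∧ q.1 ≤ c} = S₁ ∪ S₂ ∧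
      ∀ χ₁ χ₂, W₁.HasEulerChar χ₁ → W₂.HasEulerChar χ₂ → W.HasEulerChar (χ₁ + χ₂) := by
  have h1 := W₁.T₀_lt_T₁
  have h2 := W₂.T₀_lt_T₁
  refine ⟨W₁.glue W₂ (hb₁.trans hb₂), ha, hc, ?_, fun χ₁ χ₂ h₁ h₂ => h₁.glue h₂ _⟩
  subst hS₁ hS₂
  ext q
  have left : q.1 ≤ b → (q ∈ (W₁.glue W₂ (hb₁.trans hb₂)).carrier ↔ q ∈ W₁.carrier) :=
    fun hq => mem_gluedCarrier_left (hq.trans hb₂.le)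
  have right : b ≤ q.1 → (q ∈ (W₁.glue W₂ (hb₁.trans hb₂)).carrier ↔ q ∈ W₂.carrier) :=
    fun hq => mem_gluedCarrier_right (hb₁.le.trans hq)
  simp only [mem_inter_iff, mem_union, mem_ofPred_eq]
  constructor
  · rintro ⟨hq, hqa, hqc⟩
    rcases le_total q.1 b with hqb | hqb
    · exact Or.inl ⟨(left hqb).1 hq, hqa, hqb⟩
    · exact Or.inr ⟨(right hqb).1 hq, hqb, hqc⟩
  · rintro (⟨hq, hqa, hqb⟩ | ⟨hq, hqb, hqc⟩)
    · exact ⟨(left hqb).2 hq, hqa, by linarith⟩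
    · exact ⟨(right hqb).2 hq, by linarith, hqc⟩

/-- The composite surface of a bound is part of a smooth cobordism. -/
theorem LagrangianBound.exists_cobordism {Λ Λ' : OrientedLink} (b : LagrangianBound Λ Λ') (k : ℕ) :
    ∃ W : Cobordism Λ Λ', 2 * (k : ℝ) < W.T₀ ∧ W.T₁ < 2 * (k : ℝ) + 2 ∧
      W.carrier ∩ {q | 2 * (k : ℝ) ≤ q.1 ∧ q.1 ≤ 2 * (k : ℝ) + 2} = b.composite k ∧
      ∀ χ, b.HasEulerChar χ → W.HasEulerChar χ := by
  have slab : ∀ (S : Set Space4) {T : Set Space4} {j : ℕ} {x y : ℝ}, (j : ℝ) = x →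
      (j : ℝ) + 1 = y →
      (∀ q : Space4, (j : ℝ) ≤ q.1 → q.1 ≤ j + 1 → (q ∈ S ↔ q ∈ T)) →
      (∀ q ∈ T, (j : ℝ) ≤ q.1 ∧ q.1 ≤ j + 1) → S ∩ {q | x ≤ q.1 ∧ q.1 ≤ y} = T := by
    rintro S T j _ _ rfl rfl h hT
    ext q
    exact ⟨fun hq => (h q hq.2.1 hq.2.2).1 hq.1,
      fun hq => ⟨(h q (hT q hq).1 (hT q hq).2).2 hq, hT q hq⟩⟩
  have e0 : ((2 * k : ℕ) : ℝ) = 2 * k := by push_cast; ring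
  have e1 : ((2 * k : ℕ) : ℝ) + 1 = 2 * k + 1 := by push_cast; ring
  have e2 : ((2 * k + 1 : ℕ) : ℝ) = 2 * k + 1 := by push_cast; ring
  have e3 : ((2 * k + 1 : ℕ) : ℝ) + 1 = 2 * k + 2 := by push_cast; ring
  cases b with
  | upper M _ left right =>
    obtain ⟨W₁, l₁, u₁, c₁, x₁⟩ := left.exists_stacked (2 * k)
    obtain ⟨W₂, l₂, u₂, c₂, x₂⟩ := right.exists_stackedReversed (2 * k + 1)
    rw [e0] at l₁
    rw [e1] at u₁
    rw [e2] at l₂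
    rw [e3] at u₂
    obtain ⟨W, hl, hu, hc, hx⟩ := Cobordism.exists_glue_slab l₁ u₁ l₂ u₂
      (slab _ e0 e1 c₁ fun q hq => ⟨hq.1, hq.2.1⟩) (slab _ e2 e3 c₂ fun q hq => ⟨hq.1, hq.2.1⟩)
    refine ⟨W, hl, hu, hc, ?_⟩
    rintro _ ⟨χ₁, χ₂, h₁, h₂, rfl⟩
    exact hx _ _ (x₁ _ h₁) (x₂ _ h₂)
  | lower M _ left right =>
    obtain ⟨W₁, l₁, u₁, c₁, x₁⟩ := left.exists_stackedReversed (2 * k)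
    obtain ⟨W₂, l₂, u₂, c₂, x₂⟩ := right.exists_stacked (2 * k + 1)
    rw [e0] at l₁
    rw [e1] at u₁
    rw [e2] at l₂
    rw [e3] at u₂
    obtain ⟨W, hl, hu, hc, hx⟩ := Cobordism.exists_glue_slab l₁ u₁ l₂ u₂
      (slab _ e0 e1 c₁ fun q hq => ⟨hq.1, hq.2.1⟩) (slab _ e2 e3 c₂ fun q hq => ⟨hq.1, hq.2.1⟩)
    refine ⟨W, hl, hu, hc, ?_⟩
    rintro _ ⟨χ₁, χ₂, h₁, h₂, rfl⟩
    exact hx _ _ (x₁ _ h₁) (x₂ _ h₂)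

namespace LagrangianQuasiCobordism

variable {Λ Λ' : OrientedLink}

/-- The bounds are glued one at a time. The induction starts with one bound rather than none, so no
cobordism has to be built for an empty stack. The ends stay strictly inside the slab, as the next
gluing requires. -/
theorem exists_cobordism_initial (Q : LagrangianQuasiCobordism Λ Λ') (m : ℕ)
    (hm : m + 1 < Q.length + 1) :
    ∃ W : Cobordism (Q.link 0) (Q.link ⟨m + 1, hm⟩), 0 < W.T₀ ∧ W.T₁ < 2 * ((m + 1 : ℕ) : ℝ) ∧
      W.carrier ∩ {q | 0 ≤ q.1 ∧ q.1 ≤ 2 * ((m + 1 : ℕ) : ℝ)} =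
        ⋃ i : Fin (m + 1), (Q.bound (i.castLE (by omega))).composite i ∧
      ∀ e : Fin Q.length → ℤ, (∀ i, (Q.bound i).HasEulerChar (e i)) →
        W.HasEulerChar (∑ i : Fin (m + 1), e (i.castLE (by omega))) := by
  induction m with
  | zero =>
    obtain ⟨W, hl, hu, hc, hx⟩ := (Q.bound ⟨0, by omega⟩).exists_cobordism 0
    simp only [Nat.cast_zero, mul_zero, zero_add] at hl hu hc
    refine ⟨W, hl, by simpa using hu, ?_, fun e he => ?_⟩
    · simp only [zero_add, Nat.cast_one, mul_one]
      rw [hc]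
      ext q
      rw [mem_iUnion, Fin.exists_fin_one]
      rfl
    · exact (Fin.sum_univ_one fun i : Fin 1 => e (i.castLE (by omega))).symm ▸ hx _ (he _)
  | succ m ih =>
    obtain ⟨W₁, l₁, u₁, c₁, x₁⟩ := ih (by omega)
    obtain ⟨W₂, l₂, u₂, c₂, x₂⟩ := (Q.bound ⟨m + 1, by omega⟩).exists_cobordism (m + 1)
    obtain ⟨W, hl, hu, hc, hx⟩ := Cobordism.exists_glue_slab l₁ u₁ l₂ u₂ c₁ c₂
    have e : 2 * ((m + 1 : ℕ) : ℝ) + 2 = 2 * ((m + 1 + 1 : ℕ) : ℝ) := by push_cast; ring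
    rw [e] at hu hc
    refine ⟨W, hl, hu, ?_, fun e he => ?_⟩
    · rw [hc]
      ext q
      rw [mem_union, mem_iUnion, mem_iUnion]
      exact (Fin.exists_fin_succ' (P := fun i : Fin (m + 1 + 1) =>
        q ∈ (Q.bound (i.castLE (by omega))).composite i)).symm
    · rw [Fin.sum_univ_castSucc]
      exact hx _ _ (x₁ e he) (x₂ _ (he _))

/-- The composite surface of a quasi-cobordism is the compact part of a smooth cobordism with the
same Euler characteristic. -/
theorem exists_cobordism (Q : LagrangianQuasiCobordism Λ Λ') :
    ∃ W : Cobordism Λ Λ', W.compactPart = Q.composite ∧ ∀ χ, Q.HasEulerChar χ → W.HasEulerChar χ := by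
  obtain ⟨n, hn, link, rfl, rfl, bound⟩ := Q
  obtain ⟨m, rfl⟩ := Nat.exists_eq_succ_of_ne_zero hn.ne'
  obtain ⟨W, hl, hu, hc, hx⟩ := exists_cobordism_initial
    (⟨m + 1, hn, link, rfl, rfl, bound⟩ : LagrangianQuasiCobordism (link 0) _) m (by simp)
  -- The composite contains the outermost collars, so the compact part is enlarged to the full slab;
  -- this leaves the Euler characteristic unchanged.
  refine ⟨W.collared 0 _ hl hu, hc, ?_⟩
  rintro _ ⟨e, he, rfl⟩
  exact (hx e he).collared hl hu

theorem exists_cobordism_hasGenus (Q : LagrangianQuasiCobordism Λ Λ') :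
    ∃ W : Cobordism Λ Λ', W.compactPart = Q.composite ∧ ∀ g, Q.HasGenus g → W.HasGenus g := by
  obtain ⟨W, hc, hx⟩ := Q.exists_cobordism
  refine ⟨W, hc, ?_⟩
  rintro g ⟨χ, hχ, hg⟩
  exact ⟨χ, hx χ hχ, hc ▸ hg⟩

end LagrangianQuasiCobordism

end LegCob

theorem lemma6p2 (Λ Λ' : LegCob.OrientedLink)
    (hΛ : Λ.IsLegendrian) (hΛ' : Λ'.IsLegendrian) (hk : Λ.IsKnot) (hk' : Λ'.IsKnot) :
    LegCob.smoothCobordismGenus Λ Λ' ≤ LegCob.relativeLagrangianGenus Λ Λ' ∧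
      LegCob.connectedSmoothCobordismGenus Λ Λ' ≤
        LegCob.connectedRelativeLagrangianGenus Λ Λ' := by
  constructor
  · refine le_iInf fun Q => le_iInf₂ fun g hg => ?_
    obtain ⟨W, -, hW⟩ := Q.exists_cobordism_hasGenus
    exact iInf_le_of_le W (iInf₂_le g (hW g hg))
  · refine le_iInf fun Q => le_iInf₂ fun g hg => ?_
    obtain ⟨W, hc, hW⟩ := Q.exists_cobordism_hasGenus
    exact iInf_le_of_le W (iInf₂_le g ⟨hc ▸ hg.1, hW g hg.2⟩)
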